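/- Let $n\in\{2,3\}$, $t_0>0$, and let $q_0:[0,1]\to\mathbb R$ be continuous and even, $q_0(1-x)=q_0(x)$. **The model.** The periodic graph $\mathcal G_n$ has $n$ layers. Layer $i$ ($1\le i\le n$) has vertices $A_{i,p}$ and $B_{i,p}$, $p\in\mathbb Z^2$, and edges $\mathbf a_{i1}^p,\mathbf a_{i2}^p,\mathbf a_{i3}^p$ from $A_{i,p}$ to $B_{i,p}$, $B_{i,p-(1,0)}$, $B_{i,p-(0,1)}$ respectively. In addition, for each $i\neq 2$ and each $p$ there is one connecting edge from $A_{i,p}$ to $B_{2,p}$. Every edge is identified with $[0,1]$, with the type-A end at $0$. For $\theta=(\theta_1,\theta_2)\in\mathbb R^2$ the Bloch Hamiltonian $H_n(\theta)$ acts as $u_e\mapsto -u_e''+q_0u_e$ on each edge $e$, on the functions $u$ that are $H^2$ on each edge and satisfy the following, where $w_e=1$ for layer edges and $w_e=t_0$ for connecting edges. At each vertex $v$ the numbers $u_e(v)/w_e$ coincide for all edges $e$ at $v$, and $\sum_{e\ni v}w_e\,u_e'(v)=0$, derivatives being directed away from $v$. Moreover $u$ satisfies the Floquet condition $u(x+m)=e^{i(m_1\theta_1+m_2\theta_2)}u(x)$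 for all $m\in\mathbb Z^2$. The dispersion relation of $H_n$ is the set of pairs $(\theta,\lambda)$, $\lambda\in\mathbb R$, with $\lambda$ an eigenvalue of $H_n(\theta)$; branches near a point $\theta_D$ are real functions $\lambda_\pm$ on a neighbourhood of $\theta_D$ whose graphs lie in the dispersion relation. Let $\sigma(H^D)$ be the spectrum of $-d^2/dx^2+q_0$ on $[0,1]$ with Dirichlet conditions, let $\mathcal D(\lambda)$ be the discriminant (trace of the monodromy matrix over $[0,1]$) of Hill's equation $-\varphi''+q_0\varphi=\lambda\varphi$, and put $F(\theta)=1+e^{i\theta_1}+e^{i\theta_2}$, $T_0=3+t_0^2$, $\mathcal B=[-\pi,\pi]^2$. **Dirac cones and parabolic touches.** There is a Dirac cone at $(\theta_D,\lambda_D)$ if there are a positive definite quadratic form $Q$ on $\mathbb R^2$ and branches $\lambda_\pm$ near $\theta_D$ with $$\lambda_\pm(\theta)=\lambda_D\pm\sqrt{Q(\theta-\theta_D)}+O(|\theta-\theta_D|^2),\qquad \theta\to\theta_D;$$ there is a parabolic touch at $(\theta_D,\lambda_D)$ if there are such $Q$ and branches with $\lambda_\pm(\theta)=\lambda_D\pm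 Q(\theta-\theta_D)+O(|\theta-\theta_D|^3)$. Write $N(\delta)=\sqrt{\delta_1^2-\delta_1\delta_2+\delta_2^2}$; up to a constant factor this is the Euclidean length of the momentum $k\in\mathbb R^2$ with $\delta_j=k\cdot \mathbf E_j$, $\mathbf E_1,\mathbf E_2$ being the lattice vectors of the honeycomb lattice. **Theorem.** The set $\{\lambda\in\mathbb R:\mathcal D(\lambda)=0\}$ is infinite, and the following hold. (i) *Bilayer.* For each $\theta_D=\pm(2\pi/3,-2\pi/3)$ and each $\lambda_D$ with $\mathcal D(\lambda_D)=0$, the dispersion relation of $H_2$ has a parabolic touch at $(\theta_D,\lambda_D)$, with $Q=\kappa N^2$ for some $\kappa>0$. It has no Dirac cone at any $(\theta_D,\lambda_D)\in\mathcal B\times\mathbb R$ with $\lambda_D\notin\sigma(H^D)$ or $\theta_D\ne(0,0)$. (ii) *Trilayer.* For each $\theta_D=\pm(2\pi/3,-2\pi/3)$ and each $\lambda_D$ with $\mathcal D(\lambda_D)=0$, the dispersion relation of $H_3$ has at $(\theta_D,\lambda_D)$ both a parabolic touch, with $Q=\kappa N^2$ for some $\kappa>0$, and a Dirac cone, $\lambda_\pm(\theta)=\lambda_D\pm\gamma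 N(\theta-\theta_D)+O(|\theta-\theta_D|^2)$ for some $\gamma>0$, whose branches satisfy, near $\theta_D$ and for a sign $\varepsilon\in\{1,-1\}$, $$\mathcal D(\lambda_\pm(\theta))=\pm\varepsilon\,\frac{2|F(\theta)|}{\sqrt{3T_0}}.$$ Every Dirac cone of $H_3$ at a point $(\theta_D,\lambda_D)\in\mathcal B\times\mathbb R$ with $\lambda_D\notin\sigma(H^D)$ or $\theta_D\ne(0,0)$ has $\theta_D=\pm(2\pi/3,-2\pi/3)$ and $\mathcal D(\lambda_D)=0$. -/

import Mathlib

open Set Filter Topology MeasureTheory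

namespace BernalGraphene

noncomputable section

/-! The metric graph. Layers are numbered `0, …, n - 1`, for `n = 2` or `n = 3`; layer `1` is the
layer that every other layer is connected to. Vertices are pairs (layer, cell), of type A or of
type B. Every edge is identified with `[0, 1]` and runs from a type-A vertex, at `0`, to a type-B
vertex, at `1`. -/

/-- Edges of the fundamental domain: `inl (i, j)` is the `j`-th edge of the honeycomb in layer `i`,
`inr i` is the edge that connects layer `i ≠ 1` with layer `1`. -/
abbrev CellEdge (n : ℕ) [NeZero n] : Type := (Fin n × Fin 3) ⊕ {i : Fin n // i ≠ 1}

/-- Edges of the whole graph: an edge of the fundamental domain, translated by `p ∈ ℤ²`. -/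
abbrev Edge (n : ℕ) [NeZero n] : Type := CellEdge n × (ℤ × ℤ)

/-- Layer of the type-A end point. -/
def source {n : ℕ} [NeZero n] : CellEdge n → Fin n
  | .inl (i, _) => i
  | .inr i => i.1

/-- Layer of the type-B end point. -/
def target {n : ℕ} [NeZero n] : CellEdge n → Fin n
  | .inl (i, _) => i
  | .inr _ => 1

/-- The edge `c` of the cell `p` ends at a type-B vertex of the cell `p - shift c`. -/
def shift {n : ℕ} [NeZero n] : CellEdge n → ℤ × ℤ
  | .inl (_, j) => ![(0, 0), (1, 0), (0, 1)] j
  | .inr _ => (0, 0)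

/-- The type-A vertex (layer, cell) at which an edge starts. -/
def vertexA {n : ℕ} [NeZero n] (e : Edge n) : Fin n × (ℤ × ℤ) := (source e.1, e.2)

/-- The type-B vertex (layer, cell) at which an edge ends. -/
def vertexB {n : ℕ} [NeZero n] (e : Edge n) : Fin n × (ℤ × ℤ) := (target e.1, e.2 - shift e.1)

/-- Weight in the vertex conditions: `1` on edges in the layers, `t₀` on connecting edges. -/
def weight {n : ℕ} [NeZero n] (t₀ : ℝ) : CellEdge n → ℂ
  | .inl _ => 1
  | .inr _ => (t₀ : ℂ)

/-- `f` belongs to the Sobolev space `H²(0,1)`, with derivative `f₁` and second weak derivative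
`f₂` (all functions are only relevant on `[0,1]`, and `f`, `f₁` are the continuous
representatives). -/
def IsH2 (f f₁ f₂ : ℝ → ℂ) : Prop :=
  MemLp f₂ 2 (volume.restrict (Icc (0 : ℝ) 1)) ∧
  ∀ x ∈ Icc (0 : ℝ) 1,
    f x = f 0 + (∫ t in (0 : ℝ)..x, f₁ t) ∧ f₁ x = f₁ 0 + (∫ t in (0 : ℝ)..x, f₂ t)

/-- `-f'' + q₀ f = lam f` almost everywhere on `[0,1]`, where `f₂ = f''`. -/
def SolvesOnEdge (q₀ : ℝ → ℝ) (lam : ℝ) (f f₂ : ℝ → ℂ) : Prop :=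
  ∀ᵐ x ∂(volume.restrict (Icc (0 : ℝ) 1)), -f₂ x + (q₀ x : ℂ) * f x = (lam : ℂ) * f x

/-- The domain of the Bloch Hamiltonian `H_n(θ)`: functions `u` on the graph, with edgewise first
and second derivatives `u₁`, `u₂`, that are `H²` on each edge and satisfy the weighted continuity
condition, the weighted Kirchhoff condition and the Floquet condition. -/
structure InBlochDomain (n : ℕ) [NeZero n] (t₀ : ℝ) (θ : ℝ × ℝ) (u u₁ u₂ : Edge n → ℝ → ℂ) :
    Prop where
  sobolev : ∀ e, IsH2 (u e) (u₁ e) (u₂ e)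
  continuity_A : ∀ e e', vertexA e = vertexA e' →
    u e 0 / weight t₀ e.1 = u e' 0 / weight t₀ e'.1
  continuity_B : ∀ e e', vertexB e = vertexB e' →
    u e 1 / weight t₀ e.1 = u e' 1 / weight t₀ e'.1
  /-- The edges at the type-A vertex `(i, p)` are the `(c, p)` with `source c = i`. -/
  kirchhoff_A : ∀ (i : Fin n) (p : ℤ × ℤ),
    ∑ c : CellEdge n with source c = i, weight t₀ c * u₁ (c, p) 0 = 0
  /-- The edges at the type-B vertex `(i, p)` are the `(c, p + shift c)` with `target c = i`. The
  minus sign makes the derivative point away from the vertex. -/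
  kirchhoff_B : ∀ (i : Fin n) (p : ℤ × ℤ),
    ∑ c : CellEdge n with target c = i, weight t₀ c * (-u₁ (c, p + shift c) 1) = 0
  floquet : ∀ (c : CellEdge n) (p m : ℤ × ℤ), ∀ x ∈ Icc (0 : ℝ) 1,
    u (c, m + p) x = Complex.exp (((m.1 * θ.1 + m.2 * θ.2 : ℝ) : ℂ) * Complex.I) * u (c, p) x

/-- The dispersion relation of `H_n`: the pairs `(θ, lam)` such that `lam` is an eigenvalue of the
Bloch Hamiltonian `H_n(θ)`, which acts as `u ↦ -u'' + q₀ u` on each edge. -/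
def dispersionRelation (n : ℕ) [NeZero n] (t₀ : ℝ) (q₀ : ℝ → ℝ) : Set ((ℝ × ℝ) × ℝ) :=
  {z | ∃ u u₁ u₂ : Edge n → ℝ → ℂ, InBlochDomain n t₀ z.1 u u₁ u₂ ∧
    (∀ e, SolvesOnEdge q₀ z.2 (u e) (u₂ e)) ∧ ∃ e, ∃ x ∈ Icc (0 : ℝ) 1, u e x ≠ 0}

/-- The spectrum of the Dirichlet operator `-d²/dx² + q₀` on `[0,1]`. -/
def dirichletSpectrum (q₀ : ℝ → ℝ) : Set ℝ :=
  {lam | ∃ f f₁ f₂ : ℝ → ℂ, IsH2 f f₁ f₂ ∧ f 0 = 0 ∧ f 1 = 0 ∧ SolvesOnEdge q₀ lam f f₂ ∧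
    ∃ x ∈ Icc (0 : ℝ) 1, f x ≠ 0}

/-- `φ`, with derivative `φ₁`, solves Hill's equation `-φ'' + q₀ φ = lam φ` on the period
`[0,1]`. -/
def IsHillSolution (q₀ : ℝ → ℝ) (lam : ℝ) (φ φ₁ : ℝ → ℝ) : Prop :=
  ∀ x ∈ Icc (0 : ℝ) 1, HasDerivWithinAt φ (φ₁ x) (Icc 0 1) x ∧
    HasDerivWithinAt φ₁ ((q₀ x - lam) * φ x) (Icc 0 1) x

/-- `M` maps the Cauchy data at `0` of every solution to its Cauchy data at `1`. -/
def IsMonodromyMatrix (q₀ : ℝ → ℝ) (lam : ℝ) (M : Matrix (Fin 2) (Fin 2) ℝ) : Prop :=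
  ∀ φ φ₁ : ℝ → ℝ, IsHillSolution q₀ lam φ φ₁ → ![φ 1, φ₁ 1] = M.mulVec ![φ 0, φ₁ 0]

/-- The discriminant of the Hill operator: the trace of the monodromy matrix (which exists and is
unique for continuous `q₀`). -/
def discriminant (q₀ : ℝ → ℝ) (lam : ℝ) : ℝ :=
  (Classical.epsilon (IsMonodromyMatrix q₀ lam)).trace

/-- `F(θ) = 1 + e^{iθ₁} + e^{iθ₂}`. -/
def F (θ : ℝ × ℝ) : ℂ :=
  1 + Complex.exp ((θ.1 : ℂ) * Complex.I) + Complex.exp ((θ.2 : ℂ) * Complex.I)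

/-- The Brillouin zone `[-π, π]²`. -/
def brillouinZone : Set (ℝ × ℝ) := Icc (-Real.pi) Real.pi ×ˢ Icc (-Real.pi) Real.pi

/-- The two points `±(2π/3, -2π/3)`. -/
def diracPoints : Set (ℝ × ℝ) :=
  {(2 * Real.pi / 3, -(2 * Real.pi / 3)), (-(2 * Real.pi / 3), 2 * Real.pi / 3)}

/-- The binary quadratic form with coefficients `a`, `b`, `c`. -/
def form (a b c : ℝ) (δ : ℝ × ℝ) : ℝ := a * δ.1 ^ 2 + b * (δ.1 * δ.2) + c * δ.2 ^ 2

/-- Near `θD`, the functions `lm` and `lp` are branches of the dispersion relation `S`, and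
`lp θ = lamD + g (θ - θD) + O(|θ - θD|^k)`, `lm θ = lamD - g (θ - θD) + O(|θ - θD|^k)`.
For `k ≥ 1` and `g 0 = 0` this contains `lp θD = lm θD = lamD`. -/
def TouchingBranches (S : Set ((ℝ × ℝ) × ℝ)) (θD : ℝ × ℝ) (lamD : ℝ) (g : ℝ × ℝ → ℝ) (k : ℕ)
    (lm lp : ℝ × ℝ → ℝ) : Prop :=
  (∀ᶠ θ in 𝓝 θD, (θ, lm θ) ∈ S ∧ (θ, lp θ) ∈ S) ∧
  (fun θ => lp θ - (lamD + g (θ - θD))) =O[𝓝 θD] (fun θ => ‖θ - θD‖ ^ k) ∧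
  (fun θ => lm θ - (lamD - g (θ - θD))) =O[𝓝 θD] (fun θ => ‖θ - θD‖ ^ k)

/-- `lm` and `lp` form a Dirac cone with apex `(θD, lamD)`, whose opening is given by the norm
`√(a δ₁² + b δ₁ δ₂ + c δ₂²)`. -/
def DiracBranches (S : Set ((ℝ × ℝ) × ℝ)) (θD : ℝ × ℝ) (lamD a b c : ℝ)
    (lm lp : ℝ × ℝ → ℝ) : Prop :=
  0 < a ∧ b ^ 2 < 4 * a * c ∧
    TouchingBranches S θD lamD (fun δ => Real.sqrt (form a b c δ)) 2 lm lp

/-- The dispersion relation `S` has a (possibly elliptic) Dirac cone with apex `(θD, lamD)`. -/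
def HasDiracCone (S : Set ((ℝ × ℝ) × ℝ)) (θD : ℝ × ℝ) (lamD : ℝ) : Prop :=
  ∃ (a b c : ℝ) (lm lp : ℝ × ℝ → ℝ), DiracBranches S θD lamD a b c lm lp

/-- `lm` and `lp` form a parabolic touch at `(θD, lamD)`, with the positive definite leading term
`a δ₁² + b δ₁ δ₂ + c δ₂²`. -/
def ParabolicBranches (S : Set ((ℝ × ℝ) × ℝ)) (θD : ℝ × ℝ) (lamD a b c : ℝ)
    (lm lp : ℝ × ℝ → ℝ) : Prop :=
  0 < a ∧ b ^ 2 < 4 * a * c ∧ TouchingBranches S θD lamD (form a b c) 3 lm lp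

end

end BernalGraphene

open BernalGraphene

/-!
Let `c` and `s` be the cosine-like and the sine-like solution of Hill's equation. The potential is
even, so half the discriminant is `η(lam) = c(1, lam)`. As long as `s(1, lam) ≠ 0`, a solution on
an edge is determined by its end values, and its derivatives at the ends are linear in them with
the coefficients `η / s(1)` and `1 / s(1)`. The eigenvalue problem thus becomes a linear system
for the values at the `2 n` vertices of a cell (`exists_vertexSystem`, `mem_dispersionRelation`),
which depends on `lam` only through `η`. Put `X = |F θ| ^ 2`, `τ = t₀ ^ 2` and `m = n - 1`. The
layers other than layer `1` enter the system in the same way, and eliminating unknowns gives `X =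
3 (3 + τ) η ^ 2` (`freeSecular`) for vectors whose sum over these layers vanishes, which exist
only for `m ≥ 2`, and `(X - 3 (3 + τ) η ^ 2) (X - 3 (3 + m τ) η ^ 2) = 9 m τ ^ 2 η ^ 2`
(`coupledSecular`) for vectors that are constant on these layers.

At the points `± (2π/3, -2π/3)` the function `F` vanishes and `X = N ^ 2` up to cubic terms. The
first equation gives `η = ± |F| / √(3 (3 + τ))`, a cone in `(θ, η)`, the second one `η ≈ ± X / (3
τ √m)`, a parabolic touch. These are transferred to `(θ, lam)` by a local inverse of `lam ↦
η(lam)` at a zero of the discriminant (`exists_local_inverse`). Its slope and its quadratic error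
come from Lagrange's identity, which expresses `η(lam) - η(mu)`, up to a nonzero factor, as `lam -
mu` times integrals that are continuous in the parameters; no differentiation in `lam` is needed.

Conversely, suppose there is a cone at `(θ_D, lam_D)`. If `s(1, lam_D) = 0`, the secular equations
hold at nearby points of the cone, since Dirichlet eigenvalues are isolated; in the limit they
hold with `η = ± 1`, which requires `X = 9`, that is, `θ_D = 0`. Otherwise they hold at the apex
and give `|η| ≤ 1`, and there `lam ↦ η(lam)` is injective near `lam_D` (`eventually_cos_one_ne`).
The two branches are then two different roots `η` for the same `X`, and in the limit `η(lam_D)` is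
a double root, which happens only for `η = 0` and `X = 0` (`eq_zero_of_double_zero`). For two
layers this is excluded as well: only the second equation is present, and it gives `η = O(X)`, too
small for a cone.

The discriminant has infinitely many zeros because `η(k ^ 2) = cos k + O(1 / k)`
(`exists_cos_one_asymptotics`).
-/

namespace BernalGraphene

/-! ### Solutions of Hill's equation -/

section HillSolutions

variable {E : Type*} [NormedAddCommGroup E] [NormedSpace ℝ E]

/-- Vector-valued version of `IsHillSolution`: it agrees with it for `E = ℝ`, and `E = ℂ` is the
case of the edge functions of the graph. -/
def HillOn (q₀ : ℝ → ℝ) (lam : ℝ) (f f₁ : ℝ → E) : Prop :=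
  ∀ x ∈ Icc (0 : ℝ) 1, HasDerivWithinAt f (f₁ x) (Icc 0 1) x ∧
    HasDerivWithinAt f₁ ((q₀ x - lam) • f x) (Icc 0 1) x

theorem isHillSolution_iff_hillOn {q₀ : ℝ → ℝ} {lam : ℝ} {φ φ₁ : ℝ → ℝ} :
    IsHillSolution q₀ lam φ φ₁ ↔ HillOn q₀ lam φ φ₁ := Iff.rfl

theorem eq_of_hasDerivWithinAt_zero {f : ℝ → E}
    (h : ∀ x ∈ Icc (0 : ℝ) 1, HasDerivWithinAt f 0 (Icc 0 1) x) :
    ∀ x ∈ Icc (0 : ℝ) 1, f x = f 0 := by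
  refine constant_of_derivWithin_zero (fun x hx => (h x hx).differentiableWithinAt) ?_
  intro x hx
  exact (h x (Ico_subset_Icc_self hx)).derivWithin
    (uniqueDiffOn_Icc zero_lt_one x (Ico_subset_Icc_self hx))

/-- The Wronskian of a real and a vector-valued solution is constant. -/
theorem HillOn.wronskian_eq {q₀ : ℝ → ℝ} {lam : ℝ} {f f₁ : ℝ → E} {φ φ₁ : ℝ → ℝ}
    (hf : HillOn q₀ lam f f₁) (hφ : IsHillSolution q₀ lam φ φ₁) :
    ∀ x ∈ Icc (0 : ℝ) 1, φ₁ x • f x - φ x • f₁ x = φ₁ 0 • f 0 - φ 0 • f₁ 0 := by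
  refine eq_of_hasDerivWithinAt_zero (f := fun x => φ₁ x • f x - φ x • f₁ x) fun x hx => ?_
  have := ((hφ x hx).2.smul (hf x hx).1).sub ((hφ x hx).1.smul (hf x hx).2)
  refine this.congr_deriv ?_
  rw [smul_smul, mul_comm (φ x)]
  abel

theorem IsHillSolution.continuousOn {q₀ : ℝ → ℝ} {lam : ℝ} {φ φ₁ : ℝ → ℝ}
    (h : IsHillSolution q₀ lam φ φ₁) : ContinuousOn φ (Icc 0 1) :=
  fun x hx => (h x hx).1.continuousWithinAt

theorem IsHillSolution.continuousOn_deriv {q₀ : ℝ → ℝ} {lam : ℝ} {φ φ₁ : ℝ → ℝ}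
    (h : IsHillSolution q₀ lam φ φ₁) : ContinuousOn φ₁ (Icc 0 1) :=
  fun x hx => (h x hx).2.continuousWithinAt

end HillSolutions

/-! ### Existence and dependence on the spectral parameter -/

/-- The first-order system on `ℝ × ℝ` that is equivalent to Hill's equation. -/
def hillField (q₀ : ℝ → ℝ) (lam x : ℝ) (v : ℝ × ℝ) : ℝ × ℝ := (v.2, (q₀ x - lam) * v.1)

theorem norm_hillField_le {q₀ : ℝ → ℝ} {lam x K : ℝ} (hK : 1 ≤ K) (h : |q₀ x - lam| ≤ K)
    (v : ℝ × ℝ) : ‖hillField q₀ lam x v‖ ≤ K * ‖v‖ := by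
  have h1 : |v.1| ≤ ‖v‖ := norm_fst_le v
  have h2 : |v.2| ≤ ‖v‖ := norm_snd_le v
  refine max_le ?_ ?_
  · change |v.2| ≤ _
    nlinarith [norm_nonneg v]
  · change |(q₀ x - lam) * v.1| ≤ _
    rw [abs_mul]
    exact mul_le_mul h h1 (abs_nonneg _) (by linarith)

theorem hillField_sub (q₀ : ℝ → ℝ) (lam x : ℝ) (v w : ℝ × ℝ) :
    hillField q₀ lam x v - hillField q₀ lam x w = hillField q₀ lam x (v - w) := by
  ext <;> simp [hillField]; ring

theorem exists_abs_le_of_continuousOn {q₀ : ℝ → ℝ} (hq₀ : ContinuousOn q₀ (Icc (0 : ℝ) 1)) :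
    ∃ K, 1 ≤ K ∧ ∀ x ∈ Icc (0 : ℝ) 1, |q₀ x| ≤ K := by
  obtain ⟨K, hK⟩ := isCompact_Icc.exists_bound_of_continuousOn hq₀
  exact ⟨max K 1, le_max_right _ _, fun x hx => (hK x hx).trans (le_max_left _ _)⟩

/-- Truncation of the plane to the square of half-width `R`. -/
def clampProd (R : ℝ) (v : ℝ × ℝ) : ℝ × ℝ := (max (-R) (min R v.1), max (-R) (min R v.2))

theorem norm_clampProd_le {R : ℝ} (hR : 0 ≤ R) (v : ℝ × ℝ) : ‖clampProd R v‖ ≤ R := by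
  refine max_le ?_ ?_ <;> refine abs_le.2 ⟨le_max_left _ _, max_le (by linarith) (min_le_left _ _)⟩

theorem norm_clampProd_le_norm {R : ℝ} (hR : 0 ≤ R) (v : ℝ × ℝ) : ‖clampProd R v‖ ≤ ‖v‖ := by
  have key : ∀ t : ℝ, |max (-R) (min R t)| ≤ |t| := by
    intro t
    rcases max_cases (-R) (min R t) with h | h <;> rcases min_cases R t with h' | h' <;>
      rcases abs_cases t with h'' | h'' <;> rw [abs_le] <;> constructor <;> linarith
  exact max_le_max (key _) (key _)

theorem norm_clampProd_sub_le (R : ℝ) (v w : ℝ × ℝ) :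
    ‖clampProd R v - clampProd R w‖ ≤ ‖v - w‖ := by
  have key : ∀ t u : ℝ, |max (-R) (min R t) - max (-R) (min R u)| ≤ |t - u| := by
    intro t u
    have h1 := abs_max_sub_max_le_max (-R) (min R t) (-R) (min R u)
    have h2 := abs_min_sub_min_le_max R t R u
    simp only [sub_self, abs_zero, abs_nonneg, sup_of_le_right] at h1 h2
    exact h1.trans h2
  exact max_le_max (key _ _) (key _ _)

theorem clampProd_of_norm_le {R : ℝ} {v : ℝ × ℝ} (h : ‖v‖ ≤ R) : clampProd R v = v := by
  have h1 := abs_le.1 ((norm_fst_le v).trans h)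
  have h2 := abs_le.1 ((norm_snd_le v).trans h)
  ext
  · simp [clampProd, min_eq_right h1.2, max_eq_right h1.1]
  · simp [clampProd, min_eq_right h2.2, max_eq_right h2.1]

/-- Initial value problems for Hill's equation are solvable on the whole interval. The vector field
is truncated to a bounded one, for which the theorem of Picard and Lindelöf gives a solution on
all of `[0, 1]`; by Grönwall's inequality this solution never sees the truncation. -/
theorem exists_isHillSolution {q₀ : ℝ → ℝ} (hq₀ : ContinuousOn q₀ (Icc (0 : ℝ) 1))
    (lam a b : ℝ) : ∃ φ φ₁ : ℝ → ℝ, IsHillSolution q₀ lam φ φ₁ ∧ φ 0 = a ∧ φ₁ 0 = b := by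
  obtain ⟨K, hK1, hK⟩ := exists_abs_le_of_continuousOn 
    (hq₀.sub (continuousOn_const (c := lam)))
  set R : ℝ := ‖(a, b)‖ * Real.exp K with hR
  have hR0 : 0 ≤ R := by positivity
  have hPL : IsPicardLindelof (fun x v => hillField q₀ lam x (clampProd R v))
      (tmin := 0) (tmax := 1) ⟨0, by simp⟩ (a, b) ⟨K * R, by positivity⟩ 0 ⟨K * R, by positivity⟩
      ⟨K, by linarith⟩ := by
    refine ⟨fun x hx => ?_, fun v _ => ?_, fun x hx v _ => ?_, ?_⟩
    · refine LipschitzOnWith.of_dist_le_mul fun v _ w _ => ?_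
      rw [dist_eq_norm, dist_eq_norm, hillField_sub]
      refine (norm_hillField_le hK1 (hK x hx) _).trans ?_
      exact mul_le_mul_of_nonneg_left (norm_clampProd_sub_le _ _ _) (by linarith)
    · unfold hillField
      fun_prop
    · refine (norm_hillField_le hK1 (hK x hx) _).trans ?_
      exact mul_le_mul_of_nonneg_left (norm_clampProd_le hR0 _) (by linarith)
    · simp
  obtain ⟨u, hu0, hu⟩ := hPL.exists_eq_forall_mem_Icc_hasDerivWithinAt₀
  have hcont : ContinuousOn u (Icc 0 1) := fun x hx => (hu x hx).continuousWithinAt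
  have hbound : ∀ x ∈ Icc (0 : ℝ) 1, ‖u x‖ ≤ R := by
    intro x hx
    have := norm_le_gronwallBound_of_norm_deriv_right_le (δ := ‖(a, b)‖) (K := K) (ε := 0) hcont
      (fun x hx => (hu x (Ico_subset_Icc_self hx)).mono_of_mem_nhdsWithin
        (Icc_mem_nhdsGE_of_mem hx)) (by simpa using le_of_eq (congrArg norm hu0))
      (fun x hx => by
        rw [add_zero]
        refine (norm_hillField_le hK1 (hK x (Ico_subset_Icc_self hx)) _).trans ?_
        exact mul_le_mul_of_nonneg_left (norm_clampProd_le_norm hR0 _) (by linarith)) x hx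
    rw [gronwallBound_ε0] at this
    refine this.trans ?_
    rw [hR]
    gcongr
    nlinarith [hx.1, hx.2]
  refine ⟨fun x => (u x).1, fun x => (u x).2, fun x hx => ?_, by simp [hu0], by simp [hu0]⟩
  have h := hu x hx
  rw [clampProd_of_norm_le (hbound x hx)] at h
  exact ⟨h.fst, h.snd⟩

/-- Solutions with fixed initial values depend on `lam` in a locally Lipschitz manner, uniformly
on `[0, 1]`. -/
theorem exists_lipschitz_isHillSolution {q₀ : ℝ → ℝ} (hq₀ : ContinuousOn q₀ (Icc (0 : ℝ) 1))
    {φ φ₁ : ℝ → ℝ → ℝ} (h : ∀ lam, IsHillSolution q₀ lam (φ lam) (φ₁ lam)) {a b : ℝ}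
    (ha : ∀ lam, φ lam 0 = a) (hb : ∀ lam, φ₁ lam 0 = b) (r : ℝ) :
    ∃ C : ℝ, 0 ≤ C ∧ ∀ lam mu : ℝ, |lam| ≤ r → |mu| ≤ r → ∀ x ∈ Icc (0 : ℝ) 1,
      |φ lam x - φ mu x| ≤ C * |lam - mu| ∧ |φ₁ lam x - φ₁ mu x| ≤ C * |lam - mu| := by
  obtain ⟨K₀, hK₀, hqK⟩ := exists_abs_le_of_continuousOn hq₀
  set K : ℝ := K₀ + |r| with hKdef
  have hK1 : 1 ≤ K := by have := abs_nonneg r; linarith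
  have hK : ∀ lam, |lam| ≤ r → ∀ x ∈ Icc (0 : ℝ) 1, |q₀ x - lam| ≤ K := fun lam hl x hx =>
    (abs_sub _ _).trans (add_le_add (hqK x hx) (hl.trans (le_abs_self r)))
  have hderiv : ∀ lam, ∀ x ∈ Ico (0 : ℝ) 1, HasDerivWithinAt (fun x => (φ lam x, φ₁ lam x))
      (hillField q₀ lam x (φ lam x, φ₁ lam x)) (Ici x) x := fun lam x hx =>
    ((h lam x (Ico_subset_Icc_self hx)).1.prodMk
      (h lam x (Ico_subset_Icc_self hx)).2).mono_of_mem_nhdsWithin (Icc_mem_nhdsGE_of_mem hx)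
  have hcont : ∀ lam, ContinuousOn (fun x => (φ lam x, φ₁ lam x)) (Icc 0 1) := fun lam =>
    (h lam).continuousOn.prodMk (h lam).continuousOn_deriv
  set B : ℝ := ‖(a, b)‖ * Real.exp K
  have hB0 : 0 ≤ B := by positivity
  have hbound : ∀ lam, |lam| ≤ r → ∀ x ∈ Icc (0 : ℝ) 1, ‖(φ lam x, φ₁ lam x)‖ ≤ B := by
    intro lam hl x hx
    have := norm_le_gronwallBound_of_norm_deriv_right_le (δ := ‖(a, b)‖) (K := K) (ε := 0)
      (hcont lam) (hderiv lam) (by simp [ha, hb])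
      (fun x hx => by
        rw [add_zero]
        exact norm_hillField_le hK1 (hK lam hl x (Ico_subset_Icc_self hx)) _) x hx
    rw [gronwallBound_ε0] at this
    refine this.trans (mul_le_mul_of_nonneg_left (Real.exp_le_exp.2 ?_) (norm_nonneg _))
    nlinarith [hx.1, hx.2]
  refine ⟨B * Real.exp K, by positivity, fun lam mu hl hm x hx => ?_⟩
  have hdiff := norm_le_gronwallBound_of_norm_deriv_right_le (δ := 0) (K := K)
      (ε := B * |lam - mu|) ((hcont lam).sub (hcont mu))
      (fun x hx => (hderiv lam x hx).sub (hderiv mu x hx)) (by simp [ha, hb])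
      (fun x hx => by
        have hx' := Ico_subset_Icc_self hx
        have e : hillField q₀ lam x (φ lam x, φ₁ lam x) - hillField q₀ mu x (φ mu x, φ₁ mu x) =
            hillField q₀ lam x ((φ lam x, φ₁ lam x) - (φ mu x, φ₁ mu x)) +
              (0, (mu - lam) * φ mu x) := by
          ext <;> simp [hillField]; ring
        rw [e]
        refine (norm_add_le _ _).trans (add_le_add (norm_hillField_le hK1 (hK lam hl x hx') _) ?_)
        have h1 : |φ mu x| ≤ B := (norm_fst_le (φ mu x, φ₁ mu x)).trans (hbound mu hm x hx')
        rw [Prod.norm_mk, norm_zero, max_eq_right (norm_nonneg _), Real.norm_eq_abs, abs_mul,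
          abs_sub_comm mu lam, mul_comm]
        exact mul_le_mul_of_nonneg_right h1 (abs_nonneg _)) x hx
  have hfin : ‖(φ lam x, φ₁ lam x) - (φ mu x, φ₁ mu x)‖ ≤ B * Real.exp K * |lam - mu| := by
    refine hdiff.trans ?_
    rw [gronwallBound_of_K_ne_0 (by linarith)]
    have hE : Real.exp (K * (x - 0)) ≤ Real.exp K :=
      Real.exp_le_exp.2 (by nlinarith [hx.1, hx.2])
    have hA : 0 ≤ B * |lam - mu| := by positivity
    have hdiv : B * |lam - mu| / K ≤ B * |lam - mu| := div_le_self hA hK1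
    have h1 : (1 : ℝ) ≤ Real.exp (K * (x - 0)) :=
      Real.one_le_exp (by nlinarith [hx.1, hx.2])
    have h0 : 0 ≤ B * |lam - mu| / K := by positivity
    nlinarith
  exact ⟨(norm_fst_le _).trans hfin, (norm_snd_le _).trans hfin⟩

/-! ### The fundamental system and its Wronskian identities -/

/-- For every `lam`, `c lam` and `s lam` are the cosine-like and the sine-like solution of Hill's
equation, with derivatives `c₁ lam` and `s₁ lam`. -/
structure IsFundamentalSystem (q₀ : ℝ → ℝ) (c c₁ s s₁ : ℝ → ℝ → ℝ) : Prop where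
  cos : ∀ lam, IsHillSolution q₀ lam (c lam) (c₁ lam)
  sin : ∀ lam, IsHillSolution q₀ lam (s lam) (s₁ lam)
  cos_zero : ∀ lam, c lam 0 = 1
  cos_deriv_zero : ∀ lam, c₁ lam 0 = 0
  sin_zero : ∀ lam, s lam 0 = 0
  sin_deriv_zero : ∀ lam, s₁ lam 0 = 1

theorem exists_isFundamentalSystem {q₀ : ℝ → ℝ} (hq₀ : ContinuousOn q₀ (Icc (0 : ℝ) 1)) :
    ∃ c c₁ s s₁ : ℝ → ℝ → ℝ, IsFundamentalSystem q₀ c c₁ s s₁ := by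
  choose c c₁ hc hc0 hc1 using fun lam => exists_isHillSolution hq₀ lam 1 0
  choose s s₁ hs hs0 hs1 using fun lam => exists_isHillSolution hq₀ lam 0 1
  exact ⟨c, c₁, s, s₁, hc, hs, hc0, hc1, hs0, hs1⟩

theorem zero_mem_unitInterval : (0 : ℝ) ∈ Icc (0 : ℝ) 1 := ⟨le_rfl, zero_le_one⟩

theorem one_mem_unitInterval : (1 : ℝ) ∈ Icc (0 : ℝ) 1 := ⟨zero_le_one, le_rfl⟩

/-- Lagrange's identity for solutions with spectral parameters `lam` and `mu`. -/
theorem IsHillSolution.lagrange {q₀ : ℝ → ℝ} {lam mu : ℝ} {φ φ₁ ψ ψ₁ : ℝ → ℝ}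
    (hφ : IsHillSolution q₀ lam φ φ₁) (hψ : IsHillSolution q₀ mu ψ ψ₁) :
    (φ 1 * ψ₁ 1 - φ₁ 1 * ψ 1) - (φ 0 * ψ₁ 0 - φ₁ 0 * ψ 0) =
      (lam - mu) * ∫ x in (0 : ℝ)..1, φ x * ψ x := by
  have hI : IntervalIntegrable (fun x => (lam - mu) * (φ x * ψ x)) volume 0 1 :=
    (continuousOn_const.mul (hφ.continuousOn.mul hψ.continuousOn)).intervalIntegrable_of_Icc
      zero_le_one
  rw [← intervalIntegral.integral_const_mul]
  refine (intervalIntegral.integral_eq_sub_of_hasDeriv_right_of_le zero_le_one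
    (f := fun x => φ x * ψ₁ x - φ₁ x * ψ x)
    ((hφ.continuousOn.mul hψ.continuousOn_deriv).sub
      (hφ.continuousOn_deriv.mul hψ.continuousOn)) (fun x hx => ?_) hI).symm
  have hx' := Ioo_subset_Icc_self hx
  have := ((hφ x hx').1.mul (hψ x hx').2).sub ((hφ x hx').2.mul (hψ x hx').1)
  refine (this.mono_of_mem_nhdsWithin (Icc_mem_nhdsGT_of_mem ⟨hx.1.le, hx.2⟩)).congr_deriv ?_
  ring

/-- Solutions on the interval are continuous, hence a nonzero one has positive square integral. -/
theorem integral_sq_pos {φ : ℝ → ℝ} (hφ : ContinuousOn φ (Icc 0 1))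
    (h : ∃ x ∈ Icc (0 : ℝ) 1, φ x ≠ 0) : 0 < ∫ x in (0 : ℝ)..1, φ x * φ x := by
  obtain ⟨x, hx, hne⟩ := h
  refine intervalIntegral.integral_pos zero_lt_one (hφ.mul hφ) (fun x _ => mul_self_nonneg _)
    ⟨x, hx, mul_self_pos.2 hne⟩

namespace IsFundamentalSystem

variable {q₀ : ℝ → ℝ} {c c₁ s s₁ : ℝ → ℝ → ℝ} (h : IsFundamentalSystem q₀ c c₁ s s₁)

include h

theorem det_eq_one (lam : ℝ) {x : ℝ} (hx : x ∈ Icc (0 : ℝ) 1) :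
    c lam x * s₁ lam x - c₁ lam x * s lam x = 1 := by
  have := (isHillSolution_iff_hillOn.1 (h.cos lam)).wronskian_eq (h.sin lam) x hx
  simp only [smul_eq_mul, h.cos_zero, h.cos_deriv_zero, h.sin_zero, h.sin_deriv_zero] at this
  linarith

/-- Every solution is a combination of the fundamental ones. -/
theorem eq_smul_add_smul {E : Type*} [NormedAddCommGroup E] [NormedSpace ℝ E] {lam : ℝ}
    {f f₁ : ℝ → E} (hf : HillOn q₀ lam f f₁) {x : ℝ} (hx : x ∈ Icc (0 : ℝ) 1) :
    f x = c lam x • f 0 + s lam x • f₁ 0 ∧ f₁ x = c₁ lam x • f 0 + s₁ lam x • f₁ 0 := by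
  have h1 := hf.wronskian_eq (h.sin lam) x hx
  have h2 := hf.wronskian_eq (h.cos lam) x hx
  simp only [h.cos_zero, h.cos_deriv_zero, h.sin_zero, h.sin_deriv_zero, one_smul, zero_smul,
    sub_zero, zero_sub] at h1 h2
  have e2 : f₁ 0 = c lam x • f₁ x - c₁ lam x • f x := by rw [← neg_inj, ← h2]; abel
  have hd := h.det_eq_one lam hx
  rw [e2, ← h1]
  constructor
  · calc f x = (c lam x * s₁ lam x - c₁ lam x * s lam x) • f x := by rw [hd, one_smul]
      _ = _ := by module
  · calc f₁ x = (c lam x * s₁ lam x - c₁ lam x * s lam x) • f₁ x := by rw [hd, one_smul]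
      _ = _ := by module

theorem isMonodromyMatrix_iff (lam : ℝ) (M : Matrix (Fin 2) (Fin 2) ℝ) :
    IsMonodromyMatrix q₀ lam M ↔ M = !![c lam 1, s lam 1; c₁ lam 1, s₁ lam 1] := by
  constructor
  · intro hM
    have h1 := hM _ _ (h.cos lam)
    have h2 := hM _ _ (h.sin lam)
    rw [h.cos_zero, h.cos_deriv_zero] at h1
    rw [h.sin_zero, h.sin_deriv_zero] at h2
    have a1 := congrFun h1 0
    have a2 := congrFun h1 1
    have a3 := congrFun h2 0
    have a4 := congrFun h2 1
    simp [Matrix.mulVec, dotProduct, Fin.sum_univ_two] at a1 a2 a3 a4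
    ext i j
    fin_cases i <;> fin_cases j <;> simp [*]
  · rintro rfl φ φ₁ hφ
    obtain ⟨e1, e2⟩ := h.eq_smul_add_smul (isHillSolution_iff_hillOn.1 hφ) one_mem_unitInterval
    ext i
    fin_cases i <;> simp [Matrix.mulVec, dotProduct, Fin.sum_univ_two, e1, e2]

theorem discriminant_eq (lam : ℝ) : discriminant q₀ lam = c lam 1 + s₁ lam 1 := by
  have hM := Classical.epsilon_spec (p := IsMonodromyMatrix q₀ lam)
    ⟨_, (h.isMonodromyMatrix_iff lam _).2 rfl⟩
  rw [discriminant, (h.isMonodromyMatrix_iff lam _).1 hM, Matrix.trace_fin_two_of]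

/-- For an even potential, the diagonal entries of the monodromy matrix agree: reflection maps
the sine-like solution to a solution that vanishes at `1`. -/
theorem sin_deriv_one_eq (heven : ∀ x ∈ Icc (0 : ℝ) 1, q₀ (1 - x) = q₀ x) (lam : ℝ) :
    s₁ lam 1 = c lam 1 := by
  have hrefl : HillOn q₀ lam (fun x => s lam (1 - x)) (fun x => -s₁ lam (1 - x)) := by
    intro x hx
    have hx' : 1 - x ∈ Icc (0 : ℝ) 1 := ⟨by linarith [hx.2], by linarith [hx.1]⟩
    have hd : HasDerivWithinAt (fun x : ℝ => 1 - x) (-1) (Icc 0 1) x :=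
      ((hasDerivAt_id x).const_sub 1).hasDerivWithinAt
    have hmaps : MapsTo (fun x : ℝ => 1 - x) (Icc 0 1) (Icc 0 1) :=
      fun y hy => ⟨by linarith [hy.2], by linarith [hy.1]⟩
    have h1 := ((h.sin lam) (1 - x) hx').1.comp x hd hmaps
    have h2 := (((h.sin lam) (1 - x) hx').2.comp x hd hmaps).neg
    rw [heven x hx] at h2
    refine ⟨h1.congr_deriv (by ring), h2.congr_deriv ?_⟩
    rw [smul_eq_mul]
    ring
  obtain ⟨e1, e2⟩ := h.eq_smul_add_smul hrefl one_mem_unitInterval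
  simp only [sub_self, sub_zero, h.sin_zero, h.sin_deriv_zero, smul_eq_mul] at e1 e2
  have hd := h.det_eq_one lam one_mem_unitInterval
  by_cases hs : s lam 1 = 0
  · rw [hs] at e2 hd
    have : s₁ lam 1 * (s₁ lam 1 - c lam 1) = 0 := by linear_combination e2 - hd
    rcases mul_eq_zero.1 this with h0 | h0
    · rw [h0] at hd
      norm_num at hd
    · linarith
  · have : s lam 1 * (s₁ lam 1 - c lam 1) = 0 := by linear_combination e1
    linarith [(mul_eq_zero.1 this).resolve_left hs]

theorem discriminant_eq_two_mul (heven : ∀ x ∈ Icc (0 : ℝ) 1, q₀ (1 - x) = q₀ x) (lam : ℝ) :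
    discriminant q₀ lam = 2 * c lam 1 := by
  rw [h.discriminant_eq, h.sin_deriv_one_eq heven]
  ring

theorem cos_one_sq (heven : ∀ x ∈ Icc (0 : ℝ) 1, q₀ (1 - x) = q₀ x) {lam : ℝ}
    (hs : s lam 1 = 0) : c lam 1 ^ 2 = 1 := by
  have hd := h.det_eq_one lam one_mem_unitInterval
  rw [h.sin_deriv_one_eq heven, hs] at hd
  linarith

theorem sin_sub_cos_identity (heven : ∀ x ∈ Icc (0 : ℝ) 1, q₀ (1 - x) = q₀ x) (lam mu : ℝ) :
    s lam 1 * c mu 1 - c lam 1 * s mu 1 = (lam - mu) * ∫ x in (0 : ℝ)..1, s lam x * s mu x := by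
  have := (h.sin lam).lagrange (h.sin mu)
  rw [h.sin_zero, h.sin_zero, h.sin_deriv_one_eq heven, h.sin_deriv_one_eq heven] at this
  linarith

/-- Difference quotients of half the discriminant. At `lam = mu`, the bracket on the right is
positive where half the discriminant is at most `1` in absolute value and `s lam 1 ≠ 0`. -/
theorem cos_sub_cos_identity (heven : ∀ x ∈ Icc (0 : ℝ) 1, q₀ (1 - x) = q₀ x) (lam mu : ℝ) :
    (c mu 1 - c lam 1) * (s lam 1 + s mu 1) =
      (lam - mu) * (s lam 1 * s mu 1 * (∫ x in (0 : ℝ)..1, c lam x * c mu x) +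
        (1 - c lam 1 * c mu 1) * ∫ x in (0 : ℝ)..1, s lam x * s mu x) := by
  have h1 := h.sin_sub_cos_identity heven lam mu
  have h2 := (h.cos lam).lagrange (h.cos mu)
  have d1 := h.det_eq_one lam one_mem_unitInterval
  have d2 := h.det_eq_one mu one_mem_unitInterval
  rw [h.sin_deriv_one_eq heven] at d1 d2
  rw [h.cos_deriv_zero, h.cos_deriv_zero] at h2
  linear_combination (1 - c lam 1 * c mu 1) * h1 + s lam 1 * s mu 1 * h2
    - s mu 1 * c mu 1 * d1 + s lam 1 * c lam 1 * d2

end IsFundamentalSystem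

/-! ### Local behaviour of the discriminant -/

theorem exists_integral_mul_sub_le {φ : ℝ → ℝ → ℝ} (hc : ∀ lam, ContinuousOn (φ lam) (Icc 0 1))
    {r C : ℝ} (hC : 0 ≤ C) (hφ : ∀ lam mu : ℝ, |lam| ≤ r → |mu| ≤ r → ∀ x ∈ Icc (0 : ℝ) 1,
      |φ lam x - φ mu x| ≤ C * |lam - mu|) {M : ℝ} (hM : |M| ≤ r) :
    ∃ B : ℝ, 0 ≤ B ∧ ∀ lam mu : ℝ, |lam| ≤ r → |mu| ≤ r →
      |(∫ x in (0 : ℝ)..1, φ lam x * φ mu x) - ∫ x in (0 : ℝ)..1, φ M x * φ M x| ≤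
        B * (|lam - M| + |mu - M|) := by
  obtain ⟨D, hD⟩ := isCompact_Icc.exists_bound_of_continuousOn (hc M)
  have hD0 : 0 ≤ D := (norm_nonneg _).trans (hD 0 zero_mem_unitInterval)
  have hr : 0 ≤ r := (abs_nonneg _).trans hM
  set E := D + C * (2 * r)
  have hE : 0 ≤ E := by positivity
  have hb : ∀ lam, |lam| ≤ r → ∀ x ∈ Icc (0 : ℝ) 1, |φ lam x| ≤ E := by
    intro lam hl x hx
    have h1 := hφ lam M hl hM x hx
    have h2 : |φ M x| ≤ D := hD x hx
    have h3 : |lam - M| ≤ 2 * r := (abs_sub _ _).trans (by linarith)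
    have h4 : |φ lam x| ≤ |φ M x| + |φ lam x - φ M x| := by
      simpa using abs_add_le (φ M x) (φ lam x - φ M x)
    have := mul_le_mul_of_nonneg_left h3 hC
    linarith
  refine ⟨E * C, by positivity, fun lam mu hl hm => ?_⟩
  have hint : ∀ a b, IntervalIntegrable (fun x => φ a x * φ b x) volume 0 1 := fun a b =>
    ((hc a).mul (hc b)).intervalIntegrable_of_Icc zero_le_one
  rw [← intervalIntegral.integral_sub (hint _ _) (hint _ _)]
  have := intervalIntegral.norm_integral_le_of_norm_le_const (a := (0 : ℝ)) (b := 1)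
    (f := fun x => φ lam x * φ mu x - φ M x * φ M x) (C := E * C * (|lam - M| + |mu - M|)) ?_
  · simpa using this
  intro x hx
  rw [uIoc_of_le zero_le_one] at hx
  have hx' := Ioc_subset_Icc_self hx
  have e : φ lam x * φ mu x - φ M x * φ M x =
      (φ lam x - φ M x) * φ mu x + φ M x * (φ mu x - φ M x) := by ring
  rw [e, Real.norm_eq_abs]
  refine (abs_add_le _ _).trans ?_
  rw [abs_mul, abs_mul]
  have h1 := mul_le_mul (hφ lam M hl hM x hx') (hb mu hm x hx') (abs_nonneg _) (by positivity)
  have h2 := mul_le_mul (hb M hM x hx') (hφ mu M hm hM x hx') (abs_nonneg _) hE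
  linarith

theorem eventually_abs_le (M : ℝ) : ∀ᶠ lam in 𝓝 M, |lam| ≤ |M| + 1 := by
  filter_upwards [Metric.ball_mem_nhds M one_pos] with lam hl
  rw [Metric.mem_ball, Real.dist_eq] at hl
  have := abs_add_le M (lam - M)
  rw [add_sub_cancel] at this
  linarith

theorem tendsto_of_abs_sub_le {X : Type*} {l : Filter X} {f : X → ℝ} {g : X → ℝ} {y : ℝ}
    (hfg : ∀ᶠ z in l, |f z - y| ≤ g z) (hg : Tendsto g l (𝓝 0)) : Tendsto f l (𝓝 y) := by
  rw [tendsto_iff_dist_tendsto_zero]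
  exact squeeze_zero' (Eventually.of_forall fun _ => dist_nonneg) hfg hg

theorem tendsto_prod_of_abs_sub_le {I : ℝ → ℝ → ℝ} {M B y : ℝ}
    (hI : ∀ lam mu : ℝ, |lam| ≤ |M| + 1 → |mu| ≤ |M| + 1 →
      |I lam mu - y| ≤ B * (|lam - M| + |mu - M|)) :
    Tendsto (fun p : ℝ × ℝ => I p.1 p.2) (𝓝 M ×ˢ 𝓝 M) (𝓝 y) := by
  refine tendsto_of_abs_sub_le (g := fun p : ℝ × ℝ => B * (|p.1 - M| + |p.2 - M|)) ?_ ?_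
  · filter_upwards [(eventually_abs_le M).prod_mk (eventually_abs_le M)] with p hp
    exact hI _ _ hp.1 hp.2
  · rw [← nhds_prod_eq]
    exact Continuous.tendsto' (by fun_prop) _ _ (by simp)

namespace IsFundamentalSystem

variable {q₀ : ℝ → ℝ} {c c₁ s s₁ : ℝ → ℝ → ℝ} (h : IsFundamentalSystem q₀ c c₁ s s₁)
  (hq₀ : ContinuousOn q₀ (Icc (0 : ℝ) 1))

include h hq₀

theorem continuous_cos_one : Continuous fun lam => c lam 1 := by
  refine continuous_iff_continuousAt.2 fun M => ?_
  obtain ⟨C, -, hC⟩ := exists_lipschitz_isHillSolution hq₀ h.cos h.cos_zero h.cos_deriv_zero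
    (|M| + 1)
  refine tendsto_of_abs_sub_le (g := fun lam => C * |lam - M|) ?_ ?_
  · filter_upwards [eventually_abs_le M] with lam hl
    exact (hC lam M hl (by linarith) 1 one_mem_unitInterval).1
  · exact Continuous.tendsto' (by fun_prop) _ _ (by simp)

theorem continuous_sin_one : Continuous fun lam => s lam 1 := by
  refine continuous_iff_continuousAt.2 fun M => ?_
  obtain ⟨C, -, hC⟩ := exists_lipschitz_isHillSolution hq₀ h.sin h.sin_zero h.sin_deriv_zero
    (|M| + 1)
  refine tendsto_of_abs_sub_le (g := fun lam => C * |lam - M|) ?_ ?_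
  · filter_upwards [eventually_abs_le M] with lam hl
    exact (hC lam M hl (by linarith) 1 one_mem_unitInterval).1
  · exact Continuous.tendsto' (by fun_prop) _ _ (by simp)

theorem exists_integral_sin_sub_le (M : ℝ) :
    ∃ B : ℝ, 0 ≤ B ∧ ∀ lam mu : ℝ, |lam| ≤ |M| + 1 → |mu| ≤ |M| + 1 →
      |(∫ x in (0 : ℝ)..1, s lam x * s mu x) - ∫ x in (0 : ℝ)..1, s M x * s M x| ≤
        B * (|lam - M| + |mu - M|) := by
  obtain ⟨C, hC0, hC⟩ := exists_lipschitz_isHillSolution hq₀ h.sin h.sin_zero h.sin_deriv_zero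
    (|M| + 1)
  exact exists_integral_mul_sub_le (fun lam => (h.sin lam).continuousOn) hC0
    (fun lam mu hl hm x hx => (hC lam mu hl hm x hx).1) (by linarith)

theorem exists_integral_cos_sub_le (M : ℝ) :
    ∃ B : ℝ, 0 ≤ B ∧ ∀ lam mu : ℝ, |lam| ≤ |M| + 1 → |mu| ≤ |M| + 1 →
      |(∫ x in (0 : ℝ)..1, c lam x * c mu x) - ∫ x in (0 : ℝ)..1, c M x * c M x| ≤
        B * (|lam - M| + |mu - M|) := by
  obtain ⟨C, hC0, hC⟩ := exists_lipschitz_isHillSolution hq₀ h.cos h.cos_zero h.cos_deriv_zero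
    (|M| + 1)
  exact exists_integral_mul_sub_le (fun lam => (h.cos lam).continuousOn) hC0
    (fun lam mu hl hm x hx => (hC lam mu hl hm x hx).1) (by linarith)

omit hq₀ in
theorem integral_sin_sq_pos (M : ℝ) : 0 < ∫ x in (0 : ℝ)..1, s M x * s M x := by
  refine integral_sq_pos (h.sin M).continuousOn ?_
  by_contra! hz
  have hd := (h.sin M 0 zero_mem_unitInterval).1.congr (f₁ := fun _ => (0 : ℝ))
    (fun x hx => (hz x hx).symm) (hz 0 zero_mem_unitInterval).symm
  have := (uniqueDiffOn_Icc (zero_lt_one (α := ℝ)) 0 zero_mem_unitInterval).eq_deriv _ hd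
    (hasDerivWithinAt_const _ _ _)
  rw [h.sin_deriv_zero] at this
  exact one_ne_zero this

omit hq₀ in
theorem integral_cos_sq_pos (M : ℝ) : 0 < ∫ x in (0 : ℝ)..1, c M x * c M x :=
  integral_sq_pos (h.cos M).continuousOn
    ⟨0, zero_mem_unitInterval, by rw [h.cos_zero]; exact one_ne_zero⟩

variable (heven : ∀ x ∈ Icc (0 : ℝ) 1, q₀ (1 - x) = q₀ x)

include heven

/-- Dirichlet eigenvalues are isolated: eigenfunctions for different eigenvalues are orthogonal,
while nearby sine-like solutions are almost parallel. -/
theorem eventually_sin_one_ne_zero (M : ℝ) : ∀ᶠ lam in 𝓝[≠] M, s lam 1 ≠ 0 := by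
  by_cases hM : s M 1 = 0
  · obtain ⟨B, -, hB⟩ := h.exists_integral_sin_sub_le hq₀ M
    have ht := tendsto_prod_of_abs_sub_le hB
    have ht' : Tendsto (fun lam : ℝ => (lam, M)) (𝓝 M) (𝓝 M ×ˢ 𝓝 M) :=
      tendsto_id.prodMk tendsto_const_nhds
    have hev := (ht.comp ht').eventually_const_lt (h.integral_sin_sq_pos M)
    filter_upwards [hev.filter_mono nhdsWithin_le_nhds, self_mem_nhdsWithin] with lam hl hne hs
    have := h.sin_sub_cos_identity heven lam M
    rw [hs, hM] at this
    rcases mul_eq_zero.1 (show (lam - M) * _ = 0 by rw [← this]; ring) with h0 | h0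
    · exact hne (sub_eq_zero.1 h0)
    · simp only [Function.comp] at hl
      exact hl.ne' h0
  · exact ((h.continuous_sin_one hq₀).tendsto M).eventually_ne hM |>.filter_mono
      nhdsWithin_le_nhds

/-- Inside the bands and at those band edges that are not Dirichlet eigenvalues, the discriminant
is locally injective. -/
theorem eventually_cos_one_ne {M : ℝ} (hs : s M 1 ≠ 0) (hM : c M 1 ^ 2 ≤ 1) :
    ∀ᶠ p in 𝓝 M ×ˢ 𝓝 M, p.1 ≠ p.2 → c p.1 1 ≠ c p.2 1 := by
  obtain ⟨B, -, hB⟩ := h.exists_integral_sin_sub_le hq₀ M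
  obtain ⟨B', -, hB'⟩ := h.exists_integral_cos_sub_le hq₀ M
  have hts := tendsto_prod_of_abs_sub_le hB
  have htc := tendsto_prod_of_abs_sub_le hB'
  have c1 : Tendsto (fun p : ℝ × ℝ => c p.1 1) (𝓝 M ×ˢ 𝓝 M) (𝓝 (c M 1)) :=
    ((h.continuous_cos_one hq₀).tendsto M).comp tendsto_fst
  have c2 : Tendsto (fun p : ℝ × ℝ => c p.2 1) (𝓝 M ×ˢ 𝓝 M) (𝓝 (c M 1)) :=
    ((h.continuous_cos_one hq₀).tendsto M).comp tendsto_snd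
  have s1 : Tendsto (fun p : ℝ × ℝ => s p.1 1) (𝓝 M ×ˢ 𝓝 M) (𝓝 (s M 1)) :=
    ((h.continuous_sin_one hq₀).tendsto M).comp tendsto_fst
  have s2 : Tendsto (fun p : ℝ × ℝ => s p.2 1) (𝓝 M ×ˢ 𝓝 M) (𝓝 (s M 1)) :=
    ((h.continuous_sin_one hq₀).tendsto M).comp tendsto_snd
  have hpos : 0 < s M 1 * s M 1 * (∫ x in (0 : ℝ)..1, c M x * c M x) +
      (1 - c M 1 * c M 1) * ∫ x in (0 : ℝ)..1, s M x * s M x := by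
    have e1 : 0 < s M 1 * s M 1 := mul_self_pos.2 hs
    have e2 := mul_pos e1 (h.integral_cos_sq_pos M)
    have e3 : 0 ≤ (1 - c M 1 * c M 1) * ∫ x in (0 : ℝ)..1, s M x * s M x :=
      mul_nonneg (by nlinarith) (h.integral_sin_sq_pos M).le
    linarith
  have hev := (((s1.mul s2).mul htc).add ((tendsto_const_nhds.sub (c1.mul c2)).mul
    hts)).eventually_const_lt hpos
  filter_upwards [hev] with p hp hne heq
  have := h.cos_sub_cos_identity heven p.1 p.2
  rw [show c p.2 1 - c p.1 1 = 0 by linarith, zero_mul] at this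
  rcases mul_eq_zero.1 this.symm with h0 | h0
  · exact hne (sub_eq_zero.1 h0)
  · exact hp.ne' h0

/-- At a zero of the discriminant, half the discriminant has a local right inverse `l`, up to the
sign `ε`; it is approximated to second order by its tangent, and its slope `β` is positive. -/
theorem exists_local_inverse {M : ℝ} (hM : c M 1 = 0) :
    ∃ ε : ℝ, (ε = 1 ∨ ε = -1) ∧ ∃ β : ℝ, 0 < β ∧ ∃ l : ℝ → ℝ, ∃ C : ℝ, 0 ≤ C ∧
      ∀ᶠ t in 𝓝 (0 : ℝ), c (l t) 1 = ε * t ∧ |l t - (M + β * t)| ≤ C * t ^ 2 := by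
  have hsM : s M 1 ≠ 0 := by
    intro hs
    have := h.cos_one_sq heven hs
    rw [hM] at this
    norm_num at this
  obtain ⟨B, hB0, hB⟩ := h.exists_integral_sin_sub_le hq₀ M
  set J := ∫ x in (0 : ℝ)..1, s M x * s M x with hJ
  have hJ0 : 0 < J := h.integral_sin_sq_pos M
  -- The sign with which half the discriminant crosses zero is opposite to that of `s M 1`.
  obtain ⟨ε, hε, hεs⟩ : ∃ ε : ℝ, (ε = 1 ∨ ε = -1) ∧ s M 1 = -ε * |s M 1| := by
    rcases lt_or_gt_of_ne hsM with h0 | h0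
    · exact ⟨1, Or.inl rfl, by rw [abs_of_neg h0]; ring⟩
    · exact ⟨-1, Or.inr rfl, by rw [abs_of_pos h0]; ring⟩
  set σ := |s M 1| with hσ
  have hσ0 : 0 < σ := abs_pos.2 hsM
  have hε2 : ε * ε = 1 := by rcases hε with rfl | rfl <;> norm_num
  -- `g` is half the discriminant with its sign normalised so that it increases through `M`.
  set g : ℝ → ℝ := fun lam => ε * c lam 1 with hg
  have hgc : Continuous g := (h.continuous_cos_one hq₀).const_mul ε |>.congr fun _ => rfl
  have hid : ∀ lam, σ * g lam = (lam - M) * ∫ x in (0 : ℝ)..1, s lam x * s M x := by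
    intro lam
    rw [← h.sin_sub_cos_identity heven lam M, hM, hεs, hg]
    ring
  have hquad : ∀ lam, |lam| ≤ |M| + 1 → |σ * g lam - (lam - M) * J| ≤ B * (lam - M) ^ 2 := by
    intro lam hl
    have := hB lam M hl (by linarith)
    rw [sub_self, abs_zero, add_zero] at this
    rw [hid, ← mul_sub, abs_mul, ← sq_abs (lam - M)]
    nlinarith [abs_nonneg (lam - M)]
  -- Within distance `ρ` of `M`, the function `g` has slope at least `J / (2 σ)`.
  obtain ⟨ρ, hρ0, hρ1, hρB⟩ : ∃ ρ : ℝ, 0 < ρ ∧ ρ ≤ 1 ∧ B * ρ ≤ J / 2 := by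
    refine ⟨min 1 (J / (2 * (B + 1))), by positivity, min_le_left _ _, ?_⟩
    have h1 : B * min 1 (J / (2 * (B + 1))) ≤ B * (J / (2 * (B + 1))) :=
      mul_le_mul_of_nonneg_left (min_le_right _ _) hB0
    have h2 : B * (J / (2 * (B + 1))) ≤ (B + 1) * (J / (2 * (B + 1))) :=
      mul_le_mul_of_nonneg_right (by linarith) (by positivity)
    have h3 : (B + 1) * (J / (2 * (B + 1))) = J / 2 := by field_simp
    linarith
  have habs : ∀ d : ℝ, |d| ≤ ρ → |M + d| ≤ |M| + 1 := fun d hd =>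
    (abs_add_le _ _).trans (by linarith)
  have key : ∀ t : ℝ, |t| ≤ J * ρ / (2 * σ) → ∃ lam, g lam = t ∧ |lam - M| ≤ 2 * σ / J * |t| := by
    intro t ht
    set d := 2 * σ / J * |t| with hd
    have hd0 : 0 ≤ d := by positivity
    have hdJ : d * J = 2 * σ * |t| := by rw [hd]; field_simp
    have hdρ : d ≤ ρ := by
      rw [hd, div_mul_eq_mul_div, div_le_iff₀ hJ0]
      have := mul_le_mul_of_nonneg_left ht (show 0 ≤ 2 * σ by positivity)
      have e : 2 * σ * (J * ρ / (2 * σ)) = ρ * J := by field_simp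
      linarith
    have hBd : B * d ^ 2 ≤ d * J / 2 := by
      have h1 : B * d ≤ J / 2 := (mul_le_mul_of_nonneg_left hdρ hB0).trans hρB
      have := mul_le_mul_of_nonneg_right h1 hd0
      linarith
    have hp := hquad (M + d) (habs d (by rwa [abs_of_nonneg hd0]))
    have hn := hquad (M + -d) (habs (-d) (by rwa [abs_neg, abs_of_nonneg hd0]))
    rw [add_sub_cancel_left] at hp hn
    rw [neg_sq] at hn
    have hp1 := (abs_le.1 hp).1
    have hn1 := (abs_le.1 hn).2
    have hp2 : t ≤ g (M + d) := by
      have : σ * t ≤ σ * g (M + d) := by nlinarith [le_abs_self t]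
      exact le_of_mul_le_mul_left this hσ0
    have hn2 : g (M + -d) ≤ t := by
      have : σ * g (M + -d) ≤ σ * t := by nlinarith [neg_abs_le t]
      exact le_of_mul_le_mul_left this hσ0
    obtain ⟨lam, hl, hgl⟩ := intermediate_value_Icc (by linarith) hgc.continuousOn
      (show t ∈ Icc (g (M + -d)) (g (M + d)) from ⟨hn2, hp2⟩)
    exact ⟨lam, hgl, abs_le.2 ⟨by linarith [hl.1], by linarith [hl.2]⟩⟩
  choose! l hl1 hl2 using key
  refine ⟨ε, hε, σ / J, by positivity, l, B / J * (2 * σ / J) ^ 2, by positivity, ?_⟩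
  have hnhds : ∀ᶠ t in 𝓝 (0 : ℝ), |t| < J * ρ / (2 * σ) :=
    (continuous_abs.tendsto' (0 : ℝ) 0 abs_zero).eventually_lt_const (by positivity)
  filter_upwards [hnhds] with t ht
  have h1 := hl1 t ht.le
  have h2 := hl2 t ht.le
  constructor
  · have e : ε * c (l t) 1 = t := h1
    linear_combination ε * e - c (l t) 1 * hε2
  · have hρ' : |l t - M| ≤ ρ := by
      refine h2.trans ?_
      have := mul_le_mul_of_nonneg_left ht.le (show 0 ≤ 2 * σ / J by positivity)
      have e : 2 * σ / J * (J * ρ / (2 * σ)) = ρ := by field_simp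
      linarith
    have h3 := hquad (l t) (by simpa using habs (l t - M) hρ')
    rw [h1] at h3
    have e : l t - (M + σ / J * t) = -(σ * t - (l t - M) * J) / J := by field_simp; ring
    rw [e, abs_div, abs_neg, abs_of_pos hJ0, div_le_iff₀ hJ0]
    refine h3.trans ?_
    have h4 : (l t - M) ^ 2 ≤ (2 * σ / J) ^ 2 * t ^ 2 := by
      rw [← sq_abs (l t - M), ← sq_abs t, ← mul_pow]
      exact pow_le_pow_left₀ (abs_nonneg _) h2 2
    calc B * (l t - M) ^ 2 ≤ B * ((2 * σ / J) ^ 2 * t ^ 2) := mul_le_mul_of_nonneg_left h4 hB0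
      _ = _ := by field_simp

end IsFundamentalSystem

/-! ### Zeros of the discriminant -/

/-- High-energy asymptotics: the curve `e^{-ikx} (φ' + i k φ)` would be constant for zero
potential, and its velocity is bounded independently of `k`. -/
theorem IsFundamentalSystem.exists_cos_one_asymptotics {q₀ : ℝ → ℝ} {c c₁ s s₁ : ℝ → ℝ → ℝ}
    (h : IsFundamentalSystem q₀ c c₁ s s₁) (hq₀ : ContinuousOn q₀ (Icc (0 : ℝ) 1)) :
    ∃ K : ℝ, ∀ k : ℝ, 1 ≤ k → |k * c (k ^ 2) 1 - k * Real.cos k| ≤ K := by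
  obtain ⟨K, hK1, hK⟩ := exists_abs_le_of_continuousOn hq₀
  refine ⟨K * Real.exp K, fun k hk => ?_⟩
  have hk0 : 0 < k := by linarith
  set y := c (k ^ 2) with hy
  set y₁ := c₁ (k ^ 2) with hy₁
  set w : ℝ → ℂ := fun x => (y₁ x : ℂ) + Complex.I * k * y x with hw
  set v : ℝ → ℂ := fun x => Complex.exp (-(Complex.I * k) * x) * w x with hv
  have hexp : ∀ x : ℝ, ‖Complex.exp (-(Complex.I * k) * x)‖ = 1 := fun x => by
    have : -(Complex.I * k) * x = ((-(k * x) : ℝ) : ℂ) * Complex.I := by push_cast; ring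
    rw [this, Complex.norm_exp_ofReal_mul_I]
  have hderiv : ∀ x ∈ Icc (0 : ℝ) 1, HasDerivWithinAt v
      (Complex.exp (-(Complex.I * k) * x) * (q₀ x * y x : ℝ)) (Icc 0 1) x := by
    intro x hx
    have h1 := ((h.cos (k ^ 2)) x hx).1.ofReal_comp
    have h2 := ((h.cos (k ^ 2)) x hx).2.ofReal_comp
    have h3 : HasDerivWithinAt (fun x : ℝ => Complex.exp (-(Complex.I * k) * x))
        (Complex.exp (-(Complex.I * k) * x) * (-(Complex.I * k) * 1)) (Icc 0 1) x :=
      ((Complex.ofRealCLM.hasDerivAt (x := x)).const_mul (-(Complex.I * k))).cexp.hasDerivWithinAt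
    refine (h3.mul (h2.add (h1.const_mul (Complex.I * k)))).congr_deriv ?_
    simp only [Pi.add_apply]
    push_cast
    linear_combination (-(Complex.exp (-(Complex.I * k) * x)) * k ^ 2 * y x) * Complex.I_sq
  have hvw : ∀ x, ‖v x‖ = ‖w x‖ := fun x => by rw [hv]; simp only [norm_mul, hexp, one_mul]
  have hyw : ∀ x, k * |y x| ≤ ‖v x‖ := fun x => by
    rw [hvw]
    have := Complex.abs_im_le_norm (w x)
    have e : (w x).im = k * y x := by simp [hw]
    rwa [e, abs_mul, abs_of_pos hk0] at this
  have hv0 : v 0 = Complex.I * k := by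
    simp [hv, hw, hy, hy₁, h.cos_zero, h.cos_deriv_zero]
  have hvn0 : ‖v 0‖ = k := by rw [hv0]; simp [abs_of_pos hk0]
  have hvel : ∀ x ∈ Icc (0 : ℝ) 1,
      ‖Complex.exp (-(Complex.I * k) * x) * (q₀ x * y x : ℝ)‖ ≤ K * |y x| := by
    intro x hx
    rw [norm_mul, hexp, one_mul, Complex.norm_real, Real.norm_eq_abs, abs_mul]
    exact mul_le_mul_of_nonneg_right (hK x hx) (abs_nonneg _)
  have hgron : ∀ x ∈ Icc (0 : ℝ) 1, ‖v x‖ ≤ k * Real.exp K := by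
    intro x hx
    have := norm_le_gronwallBound_of_norm_deriv_right_le (δ := k) (K := K) (ε := 0)
      (fun x hx => (hderiv x hx).continuousWithinAt)
      (fun x hx => (hderiv x (Ico_subset_Icc_self hx)).mono_of_mem_nhdsWithin
        (Icc_mem_nhdsGE_of_mem hx)) hvn0.le (fun x hx => by
          refine (hvel x (Ico_subset_Icc_self hx)).trans ?_
          have h1 := hyw x
          have h2 : |y x| ≤ ‖v x‖ := by nlinarith [abs_nonneg (y x)]
          rw [add_zero]
          exact mul_le_mul_of_nonneg_left h2 (by linarith)) x hx
    rw [gronwallBound_ε0] at this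
    refine this.trans (mul_le_mul_of_nonneg_left (Real.exp_le_exp.2 ?_) hk0.le)
    nlinarith [hx.1, hx.2]
  have hdiff : ‖v 1 - v 0‖ ≤ K * Real.exp K := by
    have := (convex_Icc (0 : ℝ) 1).norm_image_sub_le_of_norm_hasDerivWithin_le hderiv
      (C := K * Real.exp K) (fun x hx => by
        refine (hvel x hx).trans (mul_le_mul_of_nonneg_left ?_ (by linarith))
        have h1 := (hyw x).trans (hgron x hx)
        exact le_of_mul_le_mul_left h1 hk0) zero_mem_unitInterval one_mem_unitInterval
    simpa using this
  have hw1 : w 1 - Complex.exp (Complex.I * k) * (Complex.I * k) =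
      Complex.exp (Complex.I * k) * (v 1 - v 0) := by
    rw [hv0, hv]
    simp only [Complex.ofReal_one, mul_one, mul_sub, ← mul_assoc, ← Complex.exp_add]
    simp
  have him : (w 1 - Complex.exp (Complex.I * k) * (Complex.I * k)).im =
      k * c (k ^ 2) 1 - k * Real.cos k := by
    have : Complex.exp (Complex.I * k) = Real.cos k + Real.sin k * Complex.I := by
      rw [mul_comm, Complex.exp_mul_I]; push_cast; rfl
    rw [this]
    simp [hw, -Complex.ofReal_cos, -Complex.ofReal_sin]
    ring
  rw [← him]
  refine (Complex.abs_im_le_norm _).trans ?_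
  rw [hw1, norm_mul]
  have : ‖Complex.exp (Complex.I * k)‖ = 1 := by
    rw [mul_comm, Complex.norm_exp_ofReal_mul_I]
  rw [this, one_mul]
  exact hdiff

/-- Half the discriminant is close to `(-1) ^ n` at `lam = (n π) ^ 2` for large `n`, hence has a
zero between any two consecutive such points. -/
theorem IsFundamentalSystem.infinite_zeros {q₀ : ℝ → ℝ} {c c₁ s s₁ : ℝ → ℝ → ℝ}
    (h : IsFundamentalSystem q₀ c c₁ s s₁) (hq₀ : ContinuousOn q₀ (Icc (0 : ℝ) 1)) :
    {lam : ℝ | c lam 1 = 0}.Infinite := by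
  obtain ⟨K, hK⟩ := h.exists_cos_one_asymptotics hq₀
  have hcont := h.continuous_cos_one hq₀
  have hpi := Real.pi_gt_three
  have hsign : ∀ n : ℕ, 1 ≤ n → K < n → 0 < (-1) ^ n * c ((n * Real.pi) ^ 2) 1 := by
    intro n hn hKn
    have hn' : (1 : ℝ) ≤ n := by exact_mod_cast hn
    have hk : K < n * Real.pi := by nlinarith
    have h1 := hK (n * Real.pi) (by nlinarith)
    rw [Real.cos_nat_mul_pi, ← mul_sub, abs_mul, abs_of_pos (by positivity)] at h1
    have h2 : |c ((n * Real.pi) ^ 2) 1 - (-1) ^ n| < 1 := by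
      by_contra! hcon
      have := mul_le_mul_of_nonneg_left hcon (show 0 ≤ n * Real.pi by positivity)
      linarith
    have h3 := abs_lt.1 h2
    rcases neg_one_pow_eq_or ℝ n with e | e <;> rw [e] at h3 ⊢ <;> linarith [h3.1, h3.2]
  refine Set.infinite_of_not_bddAbove ?_
  rintro ⟨b, hb⟩
  obtain ⟨n, hn⟩ := exists_nat_gt (max 1 (max K b))
  have hn1 : (1 : ℝ) < n := (le_max_left _ _).trans_lt hn
  have hnK : K < n := ((le_max_left _ _).trans (le_max_right _ _)).trans_lt hn
  have hnb : b < n := ((le_max_right _ _).trans (le_max_right _ _)).trans_lt hn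
  have hn1' : 1 ≤ n := by exact_mod_cast hn1.le
  have s1 := hsign n hn1' hnK
  have s2 := hsign (n + 1) (by omega) (by push_cast; linarith)
  have hle : (n * Real.pi) ^ 2 ≤ (((n + 1 : ℕ) : ℝ) * Real.pi) ^ 2 := by
    push_cast
    gcongr
    linarith
  obtain ⟨lam, hl, h0⟩ : ∃ lam ∈ Icc ((n * Real.pi) ^ 2) ((((n + 1 : ℕ) : ℝ) * Real.pi) ^ 2),
      c lam 1 = 0 := by
    rw [pow_succ] at s2
    rcases neg_one_pow_eq_or ℝ n with e | e <;> rw [e] at s1 s2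
    · exact intermediate_value_Icc' hle hcont.continuousOn ⟨by linarith, by linarith⟩
    · exact intermediate_value_Icc hle hcont.continuousOn ⟨by linarith, by linarith⟩
  have : b < lam := by
    have h1 : (n : ℝ) ≤ n * Real.pi := by nlinarith
    have h2 : n * Real.pi ≤ (n * Real.pi) ^ 2 := by nlinarith
    linarith [hl.1]
  exact absurd (hb h0) (not_le.2 this)

/-! ### Reduction to the vertices -/

theorem hasDerivWithinAt_add_integral {g : ℝ → ℂ} (hg : ContinuousOn g (Icc 0 1)) (y : ℂ) {x : ℝ}
    (hx : x ∈ Icc (0 : ℝ) 1) :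
    HasDerivWithinAt (fun x => y + ∫ t in (0 : ℝ)..x, g t) (g x) (Icc 0 1) x :=
  ODE.hasDerivWithinAt_picard_Icc (f := fun _ v => v) (u := univ) zero_mem_unitInterval
    continuous_snd.continuousOn hg (fun _ _ => mem_univ _) y hx

/-- Eigenfunctions in the Sobolev sense are classical solutions on each edge. -/
theorem IsH2.hillOn {q₀ : ℝ → ℝ} (hq₀ : ContinuousOn q₀ (Icc (0 : ℝ) 1)) {lam : ℝ}
    {f f₁ f₂ : ℝ → ℂ} (hf : IsH2 f f₁ f₂) (hs : SolvesOnEdge q₀ lam f f₂) :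
    HillOn q₀ lam f f₁ := by
  obtain ⟨hL2, hint⟩ := hf
  have hI₂ : IntegrableOn f₂ (Icc 0 1) := hL2.integrable one_le_two
  have hc₁ : ContinuousOn f₁ (Icc 0 1) := by
    have := intervalIntegral.continuousOn_primitive_interval' (f := f₂) (μ := volume)
      (a := 0) (b₁ := 0) (b₂ := 1)
      ((intervalIntegrable_iff_integrableOn_Icc_of_le zero_le_one).2 hI₂)
      (by rw [uIcc_of_le zero_le_one]; exact zero_mem_unitInterval)
    rw [uIcc_of_le zero_le_one] at this
    exact (continuousOn_const.add this).congr fun x hx => (hint x hx).2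
  have hd : ∀ x ∈ Icc (0 : ℝ) 1, HasDerivWithinAt f (f₁ x) (Icc 0 1) x := fun x hx =>
    (hasDerivWithinAt_add_integral hc₁ (f 0) hx).congr (fun y hy => (hint y hy).1) (hint x hx).1
  have hc : ContinuousOn f (Icc 0 1) := fun x hx => (hd x hx).continuousWithinAt
  have hc₂ : ContinuousOn (fun x => (q₀ x - lam) • f x) (Icc 0 1) :=
    (hq₀.sub continuousOn_const).smul hc
  have hae : ∀ᵐ x ∂(volume.restrict (Icc (0 : ℝ) 1)), f₂ x = (q₀ x - lam) • f x := by
    filter_upwards [hs] with x hx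
    rw [Complex.real_smul]
    push_cast
    linear_combination -hx
  have hint₂ : ∀ x ∈ Icc (0 : ℝ) 1, f₁ x = f₁ 0 + ∫ t in (0 : ℝ)..x, (q₀ t - lam) • f t := by
    intro x hx
    rw [(hint x hx).2]
    congr 1
    refine intervalIntegral.integral_congr_ae ?_
    rw [ae_restrict_iff' measurableSet_Icc] at hae
    filter_upwards [hae] with t ht hmem
    rw [uIoc_of_le hx.1] at hmem
    exact ht ⟨hmem.1.le, hmem.2.trans hx.2⟩
  exact fun x hx => ⟨hd x hx,
    (hasDerivWithinAt_add_integral hc₂ (f₁ 0) hx).congr hint₂ (hint₂ x hx)⟩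

theorem HillOn.isH2 {q₀ : ℝ → ℝ} (hq₀ : ContinuousOn q₀ (Icc (0 : ℝ) 1)) {lam : ℝ}
    {f f₁ : ℝ → ℂ} (hf : HillOn q₀ lam f f₁) :
    IsH2 f f₁ (fun x => (q₀ x - lam) • f x) ∧
      SolvesOnEdge q₀ lam f (fun x => (q₀ x - lam) • f x) := by
  have hc : ContinuousOn f (Icc 0 1) := fun x hx => (hf x hx).1.continuousWithinAt
  have hc₁ : ContinuousOn f₁ (Icc 0 1) := fun x hx => (hf x hx).2.continuousWithinAt
  have hc₂ : ContinuousOn (fun x => (q₀ x - lam) • f x) (Icc 0 1) :=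
    (hq₀.sub continuousOn_const).smul hc
  have ftc : ∀ g g' : ℝ → ℂ, (∀ x ∈ Icc (0 : ℝ) 1, HasDerivWithinAt g (g' x) (Icc 0 1) x) →
      ContinuousOn g' (Icc 0 1) → ∀ x ∈ Icc (0 : ℝ) 1, g x = g 0 + ∫ t in (0 : ℝ)..x, g' t := by
    intro g g' hg hg' x hx
    have hsub : Icc 0 x ⊆ Icc (0 : ℝ) 1 := Icc_subset_Icc_right hx.2
    have := intervalIntegral.integral_eq_sub_of_hasDeriv_right_of_le hx.1 (f := g) (f' := g')
      (fun y hy => ((hg y (hsub hy)).continuousWithinAt).mono hsub)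
      (fun y hy => (hg y (hsub (Ioo_subset_Icc_self hy))).mono_of_mem_nhdsWithin
        (Icc_mem_nhdsGT_of_mem ⟨hy.1.le, hy.2.trans_le hx.2⟩))
      ((hg'.mono hsub).intervalIntegrable_of_Icc hx.1)
    rw [this]
    ring
  refine ⟨⟨?_, fun x hx => ⟨ftc f f₁ (fun x hx => (hf x hx).1) hc₁ x hx,
    ftc f₁ _ (fun x hx => (hf x hx).2) hc₂ x hx⟩⟩, Eventually.of_forall fun x => ?_⟩
  · obtain ⟨B, hB⟩ := isCompact_Icc.exists_bound_of_continuousOn hc₂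
    refine MemLp.of_bound (hc₂.aestronglyMeasurable measurableSet_Icc) B ?_
    exact (ae_restrict_iff' measurableSet_Icc).2 (Eventually.of_forall hB)
  · simp only [Complex.real_smul]
    push_cast
    ring

/-- Where the sine-like solution vanishes at `1`, it is a Dirichlet eigenfunction. -/
theorem IsFundamentalSystem.mem_dirichletSpectrum {q₀ : ℝ → ℝ} {c c₁ s s₁ : ℝ → ℝ → ℝ}
    (h : IsFundamentalSystem q₀ c c₁ s s₁) (hq₀ : ContinuousOn q₀ (Icc (0 : ℝ) 1)) {lam : ℝ}
    (hs : s lam 1 = 0) : lam ∈ dirichletSpectrum q₀ := by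
  have hill : HillOn q₀ lam (fun x => (s lam x : ℂ)) (fun x => (s₁ lam x : ℂ)) := fun x hx =>
    ⟨((h.sin lam) x hx).1.ofReal_comp, ((h.sin lam) x hx).2.ofReal_comp.congr_deriv (by simp)⟩
  obtain ⟨hH2, hsol⟩ := hill.isH2 hq₀
  refine ⟨_, _, _, hH2, by simp [h.sin_zero], by simp [hs], hsol, ?_⟩
  by_contra! hz
  have := h.integral_sin_sq_pos lam
  rw [intervalIntegral.integral_congr (g := fun _ => (0 : ℝ)) (fun x hx => ?_)] at this
  · simp at this
  · rw [uIcc_of_le zero_le_one] at hx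
    have := hz x hx
    simp only [Complex.ofReal_eq_zero] at this
    simp [this]

/-- The Floquet factor of the translation by `m ∈ ℤ²`. -/
noncomputable def phase (θ : ℝ × ℝ) (m : ℤ × ℤ) : ℂ :=
  Complex.exp (((m.1 * θ.1 + m.2 * θ.2 : ℝ) : ℂ) * Complex.I)

theorem phase_add (θ : ℝ × ℝ) (m p : ℤ × ℤ) : phase θ (m + p) = phase θ m * phase θ p := by
  rw [phase, phase, phase, ← Complex.exp_add]
  congr 1
  push_cast [Prod.fst_add, Prod.snd_add]
  ring

theorem phase_zero (θ : ℝ × ℝ) : phase θ 0 = 1 := by simp [phase]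

theorem phase_ne_zero (θ : ℝ × ℝ) (m : ℤ × ℤ) : phase θ m ≠ 0 := Complex.exp_ne_zero _

theorem phase_neg_mul (θ : ℝ × ℝ) (m : ℤ × ℤ) : phase θ (-m) * phase θ m = 1 := by
  rw [← phase_add, neg_add_cancel, phase_zero]

theorem sum_phase_shift {n : ℕ} [NeZero n] (θ : ℝ × ℝ) (i : Fin n) :
    ∑ j : Fin 3, phase θ (shift (Sum.inl (i, j) : CellEdge n)) = F θ := by
  simp [Fin.sum_univ_three, shift, phase, F]

theorem sum_phase_neg_shift {n : ℕ} [NeZero n] (θ : ℝ × ℝ) (i : Fin n) :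
    ∑ j : Fin 3, phase θ (-shift (Sum.inl (i, j) : CellEdge n)) = (starRingEnd ℂ) (F θ) := by
  simp [Fin.sum_univ_three, shift, phase, F, ← Complex.exp_conj]

theorem sum_source_eq {n : ℕ} [NeZero n] (i : Fin n) (f : CellEdge n → ℂ) :
    ∑ e : CellEdge n with source e = i, f e = ∑ j : Fin 3, f (Sum.inl (i, j)) +
      if hi : i = 1 then 0 else f (Sum.inr ⟨i, hi⟩) := by
  rw [Finset.sum_filter, Fintype.sum_sum_type, Fintype.sum_prod_type]
  congr 1
  · rw [Finset.sum_eq_single i] <;> simp +contextual [source]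
  · split_ifs with hi
    · refine Finset.sum_eq_zero fun k _ => if_neg fun hk => k.2 ?_
      exact (show k.1 = i from hk).trans hi
    · rw [Finset.sum_eq_single (⟨i, hi⟩ : {i : Fin n // i ≠ 1})]
      · simp [source]
      · intro k _ hk
        exact if_neg fun hk' => hk (Subtype.ext hk')
      · simp

theorem sum_target_eq {n : ℕ} [NeZero n] (i : Fin n) (f : CellEdge n → ℂ) :
    ∑ e : CellEdge n with target e = i, f e = ∑ j : Fin 3, f (Sum.inl (i, j)) +
      if i = 1 then ∑ k : {i : Fin n // i ≠ 1}, f (Sum.inr k) else 0 := by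
  rw [Finset.sum_filter, Fintype.sum_sum_type, Fintype.sum_prod_type]
  congr 1
  · rw [Finset.sum_eq_single i] <;> simp +contextual [target]
  · split_ifs with hi <;> simp [target, eq_comm, hi]

/-- The vertex conditions for the values `a i` and `b i` at the type-A and type-B vertices of the
fundamental domain, after the edges have been eliminated; `η` is half the discriminant. -/
structure VertexSystem (n : ℕ) [NeZero n] (t₀ : ℝ) (θ : ℝ × ℝ) (η : ℂ) (a b : Fin n → ℂ) :
    Prop where
  eq_A : ∀ i, (starRingEnd ℂ) (F θ) * b i + (if i = 1 then 0 else (t₀ : ℂ) ^ 2 * b 1) =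
    η * ((3 + if i = 1 then 0 else (t₀ : ℂ) ^ 2) * a i)
  eq_B : ∀ i, F θ * a i +
      (if i = 1 then ∑ k : {i : Fin n // i ≠ 1}, (t₀ : ℂ) ^ 2 * a k else 0) =
    η * ((3 + if i = 1 then ∑ _k : {i : Fin n // i ≠ 1}, (t₀ : ℂ) ^ 2 else 0) * b i)

theorem weight_ne_zero {n : ℕ} [NeZero n] {t₀ : ℝ} (ht₀ : 0 < t₀) (e : CellEdge n) :
    weight t₀ e ≠ 0 := by
  rcases e with e | e
  · exact one_ne_zero
  · exact Complex.ofReal_ne_zero.2 ht₀.ne'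

/-- The Kirchhoff conditions at a type-A vertex in terms of the vertex values. -/
theorem kirchhoffA_iff {n : ℕ} [NeZero n] {t₀ : ℝ} {θ : ℝ × ℝ} {η : ℂ} {a b : Fin n → ℂ}
    (i : Fin n) :
    ∑ e : CellEdge n with source e = i, weight t₀ e *
      (weight t₀ e * phase θ (-shift e) * b (target e) - η * (weight t₀ e * a (source e))) = 0 ↔
    (starRingEnd ℂ) (F θ) * b i + (if i = 1 then 0 else (t₀ : ℂ) ^ 2 * b 1) =
      η * ((3 + if i = 1 then 0 else (t₀ : ℂ) ^ 2) * a i) := by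
  rw [sum_source_eq, ← sum_phase_neg_shift θ i, ← sub_eq_zero (b := η * _)]
  refine Eq.congr_left ?_
  split_ifs with hi
  · simp [weight, source, target, Finset.sum_sub_distrib, Finset.sum_mul]
    ring
  · simp [weight, source, target, Finset.sum_sub_distrib, Finset.sum_mul, shift, phase_zero,
      show ((0, 0) : ℤ × ℤ) = 0 from rfl]
    ring

/-- The Kirchhoff conditions at a type-B vertex in terms of the vertex values. -/
theorem kirchhoffB_iff {n : ℕ} [NeZero n] {t₀ : ℝ} {θ : ℝ × ℝ} {η : ℂ} {a b : Fin n → ℂ}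
    (i : Fin n) :
    ∑ e : CellEdge n with target e = i, weight t₀ e *
      (weight t₀ e * phase θ (shift e) * a (source e) - η * (weight t₀ e * b (target e))) = 0 ↔
    F θ * a i + (if i = 1 then ∑ k : {i : Fin n // i ≠ 1}, (t₀ : ℂ) ^ 2 * a k else 0) =
      η * ((3 + if i = 1 then ∑ _k : {i : Fin n // i ≠ 1}, (t₀ : ℂ) ^ 2 else 0) * b i) := by
  rw [sum_target_eq, ← sum_phase_shift θ i, ← sub_eq_zero (b := η * _)]
  refine Eq.congr_left ?_
  split_ifs with hi
  · have hz : phase θ (0, 0) = 1 := phase_zero θ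
    simp only [weight, source, target, shift, hz, mul_sub, Finset.sum_sub_distrib,
      Finset.sum_const, Finset.sum_mul, Finset.card_univ, Fintype.card_fin, nsmul_eq_mul]
    simp only [hi, ← mul_assoc, ← sq, mul_one, one_mul]
    push_cast
    ring
  · simp [weight, source, target, Finset.sum_sub_distrib, Finset.sum_mul]
    ring

section Dispersion

variable {n : ℕ} [NeZero n] {t₀ : ℝ} {q₀ : ℝ → ℝ} {c c₁ s s₁ : ℝ → ℝ → ℝ} {θ : ℝ × ℝ} {lam : ℝ}

/-- Away from the Dirichlet spectrum, an eigenfunction is determined by its vertex values, which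
solve the vertex system. -/
theorem IsFundamentalSystem.exists_vertexSystem (h : IsFundamentalSystem q₀ c c₁ s s₁)
    (hq₀ : ContinuousOn q₀ (Icc (0 : ℝ) 1)) (heven : ∀ x ∈ Icc (0 : ℝ) 1, q₀ (1 - x) = q₀ x)
    (ht₀ : 0 < t₀) (hs : s lam 1 ≠ 0) (hmem : (θ, lam) ∈ dispersionRelation n t₀ q₀) :
    ∃ a b : Fin n → ℂ, ¬ (a = 0 ∧ b = 0) ∧ VertexSystem n t₀ θ (c lam 1 : ℂ) a b := by
  obtain ⟨u, u₁, u₂, hu, hsol, ⟨e₀, p₀⟩, x₀, hx₀, hne⟩ := hmem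
  have hσ : (s lam 1 : ℂ) ≠ 0 := Complex.ofReal_ne_zero.2 hs
  have hill : ∀ e, HillOn q₀ lam (u e) (u₁ e) := fun e => (hu.sobolev e).hillOn hq₀ (hsol e)
  have hdet : (c lam 1 : ℂ) ^ 2 - c₁ lam 1 * s lam 1 = 1 := by
    have := h.det_eq_one lam one_mem_unitInterval
    rw [h.sin_deriv_one_eq heven] at this
    rw [sq]
    exact_mod_cast this
  have hend : ∀ e, s lam 1 * u₁ e 0 = u e 1 - c lam 1 * u e 0 ∧
      s lam 1 * u₁ e 1 = c lam 1 * u e 1 - u e 0 := by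
    intro e
    obtain ⟨e1, e2⟩ := h.eq_smul_add_smul (hill e) one_mem_unitInterval
    rw [h.sin_deriv_one_eq heven] at e2
    simp only [Complex.real_smul] at e1 e2
    constructor
    · rw [e1]
      ring
    · rw [e2, e1]
      linear_combination (-u e 0) * hdet
  have hfl : ∀ (e : CellEdge n) (p : ℤ × ℤ), ∀ x ∈ Icc (0 : ℝ) 1,
      u (e, p) x = phase θ p * u (e, 0) x := by
    intro e p x hx
    have := hu.floquet e 0 p x hx
    rwa [add_zero] at this
  set a : Fin n → ℂ := fun i => u (Sum.inl (i, 0), 0) 0 with ha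
  set b : Fin n → ℂ := fun i => u (Sum.inl (i, 0), 0) 1 with hb
  have hA : ∀ e : CellEdge n, u (e, 0) 0 = weight t₀ e * a (source e) := by
    intro e
    have := hu.continuity_A (e, 0) (Sum.inl (source e, 0), 0) rfl
    rw [div_eq_iff (weight_ne_zero ht₀ e)] at this
    rw [this, ha]
    simp [weight, mul_comm]
  have hB : ∀ e : CellEdge n, u (e, shift e) 1 = weight t₀ e * b (target e) := by
    intro e
    have := hu.continuity_B (e, shift e) (Sum.inl (target e, 0), 0) (by
      simp only [vertexB, target, shift, sub_self, Matrix.cons_val_zero, Prod.mk_zero_zero])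
    rw [div_eq_iff (weight_ne_zero ht₀ e)] at this
    rw [this, hb]
    simp [weight, mul_comm]
  have hB' : ∀ e : CellEdge n, u (e, 0) 1 = weight t₀ e * phase θ (-shift e) * b (target e) := by
    intro e
    have h1 := hfl e (shift e) 1 one_mem_unitInterval
    rw [hB] at h1
    linear_combination (-phase θ (-shift e)) * h1 - u (e, 0) 1 * phase_neg_mul θ (shift e)
  refine ⟨a, b, ?_, fun i => ?_, fun i => ?_⟩
  · rintro ⟨ha0, hb0⟩
    have h0 : u (e₀, 0) 0 = 0 := by rw [hA, ha0, Pi.zero_apply, mul_zero]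
    have h1 : u (e₀, 0) 1 = 0 := by rw [hB', hb0, Pi.zero_apply, mul_zero]
    have hd : u₁ (e₀, 0) 0 = 0 := by
      have := (hend (e₀, 0)).1
      rw [h0, h1, mul_zero, sub_zero] at this
      exact (mul_eq_zero.1 this).resolve_left hσ
    apply hne
    rw [hfl _ _ _ hx₀, (h.eq_smul_add_smul (hill (e₀, 0)) hx₀).1, h0, hd]
    simp
  · refine (kirchhoffA_iff i).1 ?_
    have := congrArg (fun z => (s lam 1 : ℂ) * z) (hu.kirchhoff_A i 0)
    simp only [mul_zero, Finset.mul_sum] at this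
    rw [← this]
    refine Finset.sum_congr rfl fun e _ => ?_
    rw [mul_left_comm (s lam 1 : ℂ), (hend (e, 0)).1, hA, hB']
  · refine (kirchhoffB_iff i).1 ?_
    have := congrArg (fun z => (s lam 1 : ℂ) * z) (hu.kirchhoff_B i 0)
    simp only [mul_zero, Finset.mul_sum, zero_add] at this
    rw [← this]
    refine Finset.sum_congr rfl fun e _ => ?_
    rw [mul_left_comm (s lam 1 : ℂ), mul_neg, (hend (e, shift e)).2, hB,
      hfl _ _ _ zero_mem_unitInterval, hA]
    ring

/-- Away from the Dirichlet spectrum, every nonzero solution of the vertex system extends to an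
eigenfunction. -/
theorem IsFundamentalSystem.mem_dispersionRelation (h : IsFundamentalSystem q₀ c c₁ s s₁)
    (hq₀ : ContinuousOn q₀ (Icc (0 : ℝ) 1)) (heven : ∀ x ∈ Icc (0 : ℝ) 1, q₀ (1 - x) = q₀ x)
    (ht₀ : 0 < t₀) (hs : s lam 1 ≠ 0) {a b : Fin n → ℂ} (hab : ¬ (a = 0 ∧ b = 0))
    (hV : VertexSystem n t₀ θ (c lam 1 : ℂ) a b) : (θ, lam) ∈ dispersionRelation n t₀ q₀ := by
  have hσ : (s lam 1 : ℂ) ≠ 0 := Complex.ofReal_ne_zero.2 hs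
  have hdet : (c lam 1 : ℂ) ^ 2 - c₁ lam 1 * s lam 1 = 1 := by
    have := h.det_eq_one lam one_mem_unitInterval
    rw [h.sin_deriv_one_eq heven] at this
    rw [sq]
    exact_mod_cast this
  -- `A e` and `B e` are the end values of the edge function, `D e` its derivative at `0`.
  set A : Edge n → ℂ := fun e => weight t₀ e.1 * (phase θ e.2 * a (source e.1)) with hA
  set B : Edge n → ℂ := fun e => weight t₀ e.1 * (phase θ (e.2 - shift e.1) * b (target e.1))
    with hB
  set D : Edge n → ℂ := fun e => (B e - c lam 1 * A e) / s lam 1 with hD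
  set u : Edge n → ℝ → ℂ := fun e x => c lam x * A e + s lam x * D e with hu
  set u₁ : Edge n → ℝ → ℂ := fun e x => c₁ lam x * A e + s₁ lam x * D e with hu₁
  have hill : ∀ e, HillOn q₀ lam (u e) (u₁ e) := by
    intro e x hx
    have hc := (h.cos lam) x hx
    have hs' := (h.sin lam) x hx
    refine ⟨(hc.1.ofReal_comp.mul_const _).add (hs'.1.ofReal_comp.mul_const _),
      ((hc.2.ofReal_comp.mul_const _).add (hs'.2.ofReal_comp.mul_const _)).congr_deriv ?_⟩
    simp only [hu, Complex.real_smul]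
    push_cast
    ring
  have hu0 : ∀ e, u e 0 = A e := fun e => by simp [hu, h.cos_zero, h.sin_zero]
  have hu1 : ∀ e, u e 1 = B e := fun e => by
    simp only [hu, hD]
    field_simp
    ring
  have hd0 : ∀ e, s lam 1 * u₁ e 0 = B e - c lam 1 * A e := fun e => by
    simp only [hu₁, hD, h.cos_deriv_zero, h.sin_deriv_zero]
    field_simp
    simp
  have hd1 : ∀ e, s lam 1 * u₁ e 1 = c lam 1 * B e - A e := fun e => by
    simp only [hu₁, hD, h.sin_deriv_one_eq heven]
    field_simp
    linear_combination (-A e) * hdet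
  have hphase : ∀ (m : ℤ × ℤ) (e : CellEdge n) (p : ℤ × ℤ),
      A (e, m + p) = phase θ m * A (e, p) ∧ B (e, m + p) = phase θ m * B (e, p) := by
    intro m e p
    simp only [hA, hB, add_sub_assoc, phase_add]
    constructor <;> ring
  refine ⟨u, u₁, fun e x => (q₀ x - lam) • u e x, ⟨fun e => ((hill e).isH2 hq₀).1,
    fun e e' hv => ?_, fun e e' hv => ?_, fun i p => ?_, fun i p => ?_, fun e p m x _ => ?_⟩,
    fun e => ((hill e).isH2 hq₀).2, ?_⟩
  · obtain ⟨h1, h2⟩ : source e.1 = source e'.1 ∧ e.2 = e'.2 := Prod.ext_iff.1 hv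
    rw [hu0, hu0, hA]
    simp only [mul_div_cancel_left₀ _ (weight_ne_zero ht₀ _)]
    rw [h1, h2]
  · obtain ⟨h1, h2⟩ : target e.1 = target e'.1 ∧ e.2 - shift e.1 = e'.2 - shift e'.1 :=
      Prod.ext_iff.1 hv
    rw [hu1, hu1, hB]
    simp only [mul_div_cancel_left₀ _ (weight_ne_zero ht₀ _)]
    rw [h1, h2]
  · have := congrArg (fun z => phase θ p * z) ((kirchhoffA_iff i).2 (hV.eq_A i))
    simp only [mul_zero, Finset.mul_sum] at this
    refine (mul_eq_zero.1 (?_ : (s lam 1 : ℂ) * _ = 0)).resolve_left hσ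
    rw [← this, Finset.mul_sum]
    refine Finset.sum_congr rfl fun e _ => ?_
    rw [mul_left_comm, hd0]
    simp only [hA, hB, sub_eq_add_neg p, phase_add]
    ring
  · have := congrArg (fun z => phase θ p * z) ((kirchhoffB_iff i).2 (hV.eq_B i))
    simp only [mul_zero, Finset.mul_sum] at this
    refine (mul_eq_zero.1 (?_ : (s lam 1 : ℂ) * _ = 0)).resolve_left hσ
    rw [← this, Finset.mul_sum]
    refine Finset.sum_congr rfl fun e _ => ?_
    rw [mul_left_comm, mul_neg, hd1]
    simp only [hA, hB, add_sub_cancel_right, phase_add]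
    ring
  · change u (e, m + p) x = phase θ m * u (e, p) x
    simp only [hu, hD, (hphase m e p).1, (hphase m e p).2]
    ring
  · by_contra! hz
    refine hab ⟨funext fun i => ?_, funext fun i => ?_⟩
    · have := hz (Sum.inl (i, 0), 0) 0 zero_mem_unitInterval
      rw [hu0] at this
      simpa [hA, weight, phase_zero, source] using this
    · have := hz (Sum.inl (i, 0), 0) 1 one_mem_unitInterval
      rw [hu1] at this
      simpa [hB, weight, phase_ne_zero, target] using this

end Dispersion

/-! ### The secular equations -/

/-- Secular function of the modes that vanish on the type-B vertices of layer `1` and have zero sum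
over the other layers. The arguments are `τ = t₀²`, half the discriminant `η`, and `X = |F θ|²`. -/
def freeSecular (τ η X : ℝ) : ℝ := X - 3 * (3 + τ) * η ^ 2

/-- Secular function of the modes that are equal on the `m` layers other than layer `1`. -/
def coupledSecular (m τ η X : ℝ) : ℝ :=
  (X - 3 * (3 + τ) * η ^ 2) * (X - 3 * (3 + m * τ) * η ^ 2) - 9 * m * τ ^ 2 * η ^ 2

theorem card_ne_one (n : ℕ) [NeZero n] : Fintype.card {i : Fin n // i ≠ 1} = n - 1 := by
  simp [Fintype.card_subtype_compl]

/-- Solvability of the vertex system forces one of the secular equations; the modes of the first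
kind need a nonzero vector of zero sum on the layers other than layer `1`. -/
theorem VertexSystem.secular {n : ℕ} [NeZero n] {t₀ : ℝ} (ht₀ : 0 < t₀) {θ : ℝ × ℝ} {η : ℝ}
    {a b : Fin n → ℂ} (hab : ¬ (a = 0 ∧ b = 0)) (hV : VertexSystem n t₀ θ (η : ℂ) a b) :
    coupledSecular (n - 1 : ℕ) (t₀ ^ 2) η (‖F θ‖ ^ 2) = 0 ∨
      freeSecular (t₀ ^ 2) η (‖F θ‖ ^ 2) = 0 ∧
        ∃ v : {i : Fin n // i ≠ 1} → ℂ, v ≠ 0 ∧ ∑ k, v k = 0 := by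
  have hF : F θ * (starRingEnd ℂ) (F θ) = ((‖F θ‖ ^ 2 : ℝ) : ℂ) := by
    rw [Complex.mul_conj']; push_cast; rfl
  set X := ‖F θ‖ ^ 2 with hX
  set Fc := (starRingEnd ℂ) (F θ) with hFc
  set m : ℝ := ((n - 1 : ℕ) : ℝ) with hm
  have hτ : ((t₀ : ℂ) ^ 2) ≠ 0 := pow_ne_zero 2 (Complex.ofReal_ne_zero.2 ht₀.ne')
  have hA1 : Fc * b 1 = 3 * η * a 1 := by
    have := hV.eq_A 1
    simp only [if_true] at this
    linear_combination this
  have hA : ∀ i, i ≠ 1 → Fc * b i + t₀ ^ 2 * b 1 = η * (3 + t₀ ^ 2) * a i := by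
    intro i hi
    have := hV.eq_A i
    simp only [hi, if_false] at this
    linear_combination this
  have hB : ∀ i, i ≠ 1 → F θ * a i = 3 * η * b i := by
    intro i hi
    have := hV.eq_B i
    simp only [hi, if_false] at this
    linear_combination this
  have hB1 : F θ * a 1 + t₀ ^ 2 * ∑ k : {i : Fin n // i ≠ 1}, a k =
      η * (3 + m * t₀ ^ 2) * b 1 := by
    have := hV.eq_B 1
    simp only [if_true, ← Finset.mul_sum, Finset.sum_const, Finset.card_univ, card_ne_one,
      nsmul_eq_mul] at this
    rw [this, hm]
    push_cast
    ring
  have hA' : ∀ i, i ≠ 1 → ((X : ℂ) - 3 * (3 + t₀ ^ 2) * η ^ 2) * a i = -(3 * η * t₀ ^ 2) * b 1 := by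
    intro i hi
    linear_combination 3 * (η : ℂ) * hA i hi + Fc * hB i hi + (-a i) * hF
  have hS : ((X : ℂ) - 3 * (3 + t₀ ^ 2) * η ^ 2) * ∑ k : {i : Fin n // i ≠ 1}, a k =
      -(3 * η * t₀ ^ 2) * m * b 1 := by
    rw [Finset.mul_sum, Finset.sum_congr rfl (fun k _ => hA' k.1 k.2), Finset.sum_const,
      Finset.card_univ, card_ne_one, nsmul_eq_mul, hm]
    push_cast
    ring
  have hB1' : ((X : ℂ) - 3 * (3 + m * t₀ ^ 2) * η ^ 2) * b 1 =
      -(3 * η * t₀ ^ 2) * ∑ k : {i : Fin n // i ≠ 1}, a k := by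
    linear_combination 3 * (η : ℂ) * hB1 + F θ * hA1 - b 1 * hF
  have hdet : ((coupledSecular m (t₀ ^ 2) η X : ℝ) : ℂ) * b 1 = 0 := by
    rw [coupledSecular]
    push_cast
    linear_combination ((X : ℂ) - 3 * (3 + t₀ ^ 2) * η ^ 2) * hB1' - 3 * η * t₀ ^ 2 * hS
  rcases mul_eq_zero.1 hdet with h0 | hb1
  · exact Or.inl (Complex.ofReal_eq_zero.1 h0)
  by_cases hη : η = 0
  · by_cases hX0 : X = 0
    · left
      rw [coupledSecular, hη, hX0]
      ring
    · -- For `η = 0` and `F θ ≠ 0` the vertex system has only the zero solution.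
      have hF0 : F θ ≠ 0 := fun h0 => hX0 (by rw [hX, h0]; simp)
      have hFc0 : Fc ≠ 0 := fun h0 => hF0 (by simpa [hFc] using h0)
      have hηC : (η : ℂ) = 0 := by rw [hη]; simp
      have ha : ∀ i, i ≠ 1 → a i = 0 := fun i hi => by
        have := hB i hi
        rw [hηC, mul_zero, zero_mul] at this
        exact (mul_eq_zero.1 this).resolve_left hF0
      have hb : ∀ i, i ≠ 1 → b i = 0 := fun i hi => by
        have := hA i hi
        rw [hηC, hb1, mul_zero, add_zero, zero_mul, zero_mul] at this
        exact (mul_eq_zero.1 this).resolve_left hFc0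
      have ha1 : a 1 = 0 := by
        have := hB1
        rw [Finset.sum_eq_zero fun (k : {i : Fin n // i ≠ 1}) _ => ha k.1 k.2, hb1, mul_zero,
          mul_zero, add_zero] at this
        exact (mul_eq_zero.1 this).resolve_left hF0
      refine absurd ⟨funext fun i => ?_, funext fun i => ?_⟩ hab
      · by_cases hi : i = 1
        · rw [hi, ha1]; rfl
        · exact ha i hi
      · by_cases hi : i = 1
        · rw [hi, hb1]; rfl
        · exact hb i hi
  · have hηC : (3 * (η : ℂ)) ≠ 0 := by
      refine mul_ne_zero (by norm_num) (Complex.ofReal_ne_zero.2 hη)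
    have ha1 : a 1 = 0 := by
      rw [hb1, mul_zero] at hA1
      exact (mul_eq_zero.1 hA1.symm).resolve_left hηC
    right
    have hv : (fun k : {i : Fin n // i ≠ 1} => a k) ≠ 0 := by
      intro hv
      have ha : ∀ i, i ≠ 1 → a i = 0 := fun i hi => congrFun hv ⟨i, hi⟩
      have hb : ∀ i, i ≠ 1 → b i = 0 := fun i hi => by
        have := hB i hi
        rw [ha i hi, mul_zero] at this
        exact (mul_eq_zero.1 this.symm).resolve_left hηC
      refine hab ⟨funext fun i => ?_, funext fun i => ?_⟩
      · by_cases hi : i = 1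
        · rw [hi, ha1]; rfl
        · exact ha i hi
      · by_cases hi : i = 1
        · rw [hi, hb1]; rfl
        · exact hb i hi
    refine ⟨?_, _, hv, ?_⟩
    · obtain ⟨k, hk⟩ := Function.ne_iff.1 hv
      have := hA' k.1 k.2
      rw [hb1, mul_zero] at this
      have h0 := (mul_eq_zero.1 this).resolve_right hk
      rw [freeSecular]
      exact_mod_cast h0
    · rw [hb1, mul_zero] at hB1'
      refine (mul_eq_zero.1 hB1'.symm).resolve_left (neg_ne_zero.2 (mul_ne_zero hηC hτ))

/-- Modes that are equal on the layers other than layer `1`. -/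
theorem exists_vertexSystem_of_coupledSecular {n : ℕ} [NeZero n] (hn : 2 ≤ n) {t₀ : ℝ}
    (ht₀ : 0 < t₀) {θ : ℝ × ℝ} {η : ℝ}
    (h : coupledSecular (n - 1 : ℕ) (t₀ ^ 2) η (‖F θ‖ ^ 2) = 0) :
    ∃ a b : Fin n → ℂ, ¬ (a = 0 ∧ b = 0) ∧ VertexSystem n t₀ θ (η : ℂ) a b := by
  have hF : F θ * (starRingEnd ℂ) (F θ) = ((‖F θ‖ ^ 2 : ℝ) : ℂ) := by
    rw [Complex.mul_conj']; push_cast; rfl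
  have h01 : (0 : Fin n) ≠ 1 := by
    obtain ⟨k, rfl⟩ : ∃ k, n = k + 2 := ⟨n - 2, by omega⟩
    exact Fin.zero_ne_one
  by_cases hη : η = 0
  · have hX : F θ = 0 := by
      rw [coupledSecular, hη] at h
      simpa using h
    refine ⟨0, Pi.single 0 1, fun h0 => ?_, fun i => ?_, fun i => ?_⟩
    · simpa using congrFun h0.2 0
    · simp [hX, h01.symm]
    · simp [hη]
  · have hηC : (η : ℂ) ≠ 0 := Complex.ofReal_ne_zero.2 hη
    set X := ‖F θ‖ ^ 2 with hX
    have hC : ((X : ℂ) - 3 * (3 + t₀ ^ 2) * η ^ 2) *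
        ((X : ℂ) - 3 * (3 + ((n - 1 : ℕ) : ℂ) * t₀ ^ 2) * η ^ 2) -
          9 * ((n - 1 : ℕ) : ℂ) * (t₀ ^ 2) ^ 2 * η ^ 2 = 0 := by
      rw [coupledSecular] at h
      exact_mod_cast h
    set B : ℂ := -((X : ℂ) - 3 * (3 + t₀ ^ 2) * η ^ 2) with hB
    refine ⟨fun i => if i = 1 then (starRingEnd ℂ) (F θ) * B / (3 * η) else 3 * η * t₀ ^ 2,
      fun i => if i = 1 then B else F θ * t₀ ^ 2, fun h0 => ?_, fun i => ?_, fun i => ?_⟩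
    · have := congrFun h0.1 0
      simp [h01, hηC, ht₀.ne'] at this
    · by_cases hi : i = 1
      · simp only [hi, if_true]
        field_simp
        ring
      · simp only [hi, if_false, if_true]
        rw [hB]
        linear_combination t₀ ^ 2 * hF
    · by_cases hi : i = 1
      · have e : ∑ k : {i : Fin n // i ≠ 1}, (t₀ : ℂ) ^ 2 *
            (if k.1 = 1 then (starRingEnd ℂ) (F θ) * B / (3 * η) else 3 * η * t₀ ^ 2) =
            ((n - 1 : ℕ) : ℂ) * (t₀ ^ 2 * (3 * η * t₀ ^ 2)) := by
          rw [Finset.sum_congr rfl fun k _ => by rw [if_neg k.2], Finset.sum_const,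
            Finset.card_univ, card_ne_one, nsmul_eq_mul]
        simp only [hi, if_true]
        rw [e, Finset.sum_const, Finset.card_univ, card_ne_one, nsmul_eq_mul]
        field_simp
        linear_combination B * hF - hC
      · simp only [hi, if_false]
        ring

/-- Modes that are antisymmetric with respect to the middle layer. -/
theorem exists_vertexSystem_of_freeSecular {t₀ : ℝ} {θ : ℝ × ℝ} {η : ℝ}
    (h : freeSecular (t₀ ^ 2) η (‖F θ‖ ^ 2) = 0) :
    ∃ a b : Fin 3 → ℂ, ¬ (a = 0 ∧ b = 0) ∧ VertexSystem 3 t₀ θ (η : ℂ) a b := by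
  have hF : F θ * (starRingEnd ℂ) (F θ) = ((‖F θ‖ ^ 2 : ℝ) : ℂ) := by
    rw [Complex.mul_conj']; push_cast; rfl
  have hC : ((‖F θ‖ ^ 2 : ℝ) : ℂ) - 3 * (3 + t₀ ^ 2) * η ^ 2 = 0 := by
    rw [freeSecular] at h
    exact_mod_cast h
  -- For `η = 0`, both `F θ` and the quotient `F θ / (3 * η)` vanish.
  have hη : F θ = 3 * η * (F θ / (3 * η)) := by
    by_cases hη : η = 0
    · rw [freeSecular, hη] at h
      have : F θ = 0 := by simpa using h
      simp [this]
    · have : (η : ℂ) ≠ 0 := Complex.ofReal_ne_zero.2 hη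
      field_simp
  have hη' : (starRingEnd ℂ) (F θ) * (F θ / (3 * η)) = η * (3 + t₀ ^ 2) := by
    by_cases h0 : η = 0
    · simp [h0]
    · have : (η : ℂ) ≠ 0 := Complex.ofReal_ne_zero.2 h0
      field_simp
      linear_combination hF + hC
  have hsum : ∀ f : Fin 3 → ℂ, ∑ k : {i : Fin 3 // i ≠ 1}, f k = f 0 + f 2 := by
    intro f
    rw [← Finset.sum_subtype (Finset.univ.erase 1) (by simp) f,
      Finset.sum_erase_eq_sub (Finset.mem_univ _), Fin.sum_univ_three]
    ring
  set d := F θ / (3 * η)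
  refine ⟨![1, 0, -1], ![d, 0, -d], fun h0 => ?_, fun i => ?_, fun i => ?_⟩
  · simpa using congrFun h0.1 0
  · fin_cases i
    · simp
      linear_combination hη'
    · simp
    · simp
      linear_combination -hη'
  · rw [hsum fun k => (t₀ : ℂ) ^ 2 * ![(1 : ℂ), 0, -1] k]
    fin_cases i
    · simp
      linear_combination hη
    · simp
    · simp
      linear_combination hη

/-! ### Algebra of the secular equations -/

theorem sq_le_one_of_freeSecular {τ η X : ℝ} (hτ : 0 < τ) (hX : X ≤ 9)
    (h : freeSecular τ η X = 0) : η ^ 2 ≤ 1 := by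
  rw [freeSecular] at h
  nlinarith [sq_nonneg η]

theorem sq_le_one_of_coupledSecular {m τ η X : ℝ} (hm : 0 < m) (hτ : 0 < τ) (hX : X ≤ 9)
    (h : coupledSecular m τ η X = 0) : η ^ 2 ≤ 1 := by
  rw [coupledSecular] at h
  set y := η ^ 2
  by_contra! hy
  have h1 : 3 * τ * y < 3 * (3 + τ) * y - X := by nlinarith
  have h2 : 3 * (m * τ) * y < 3 * (3 + m * τ) * y - X := by nlinarith
  have hmτ : 0 < m * τ := mul_pos hm hτ
  have h3 := mul_lt_mul'' h1 h2 (by positivity) (by positivity)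
  have h4 : 0 < 9 * m * τ ^ 2 * y * (y - 1) := by
    have : 0 < y - 1 := by linarith
    positivity
  nlinarith

theorem freeSecular_ne_zero {τ η X : ℝ} (hτ : 0 < τ) (hη : η ^ 2 = 1) (hX : X < 9) :
    freeSecular τ η X ≠ 0 := by
  rw [freeSecular, hη]
  linarith

theorem coupledSecular_ne_zero {m τ η X : ℝ} (hm : 0 < m) (hτ : 0 < τ) (hη : η ^ 2 = 1)
    (hX : X < 9) : coupledSecular m τ η X ≠ 0 := by
  rw [coupledSecular, hη]
  have hmτ : 0 < m * τ := mul_pos hm hτ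
  have h1 : 3 * τ < 3 * (3 + τ) - X := by linarith
  have h2 : 3 * (m * τ) < 3 * (3 + m * τ) - X := by linarith
  have h3 := mul_lt_mul'' h1 h2 (by positivity) (by positivity)
  nlinarith

/-- Difference quotient of `freeSecular` in `η`. -/
def freeSlope (τ η η' : ℝ) : ℝ := -(3 * (3 + τ)) * (η + η')

/-- Difference quotient of `coupledSecular` in `η`. -/
def coupledSlope (m τ η η' X : ℝ) : ℝ :=
  (η + η') * (9 * (3 + τ) * (3 + m * τ) * (η ^ 2 + η' ^ 2) -
    (3 * (6 + (m + 1) * τ) * X + 9 * m * τ ^ 2))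

theorem freeSecular_sub (τ η η' X : ℝ) :
    freeSecular τ η X - freeSecular τ η' X = (η - η') * freeSlope τ η η' := by
  simp only [freeSecular, freeSlope]
  ring

theorem coupledSecular_sub (m τ η η' X : ℝ) :
    coupledSecular m τ η X - coupledSecular m τ η' X = (η - η') * coupledSlope m τ η η' X := by
  simp only [coupledSecular, coupledSlope]
  ring

/-- The product of the secular functions has double zeros in `η` only at `η = 0`, `X = 0`. -/
theorem eq_zero_of_double_zero {m τ η X : ℝ} (hm : 0 < m) (hτ : 0 < τ) (hX : 0 ≤ X)
    (h : freeSecular τ η X * coupledSecular m τ η X = 0)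
    (h' : freeSlope τ η η * coupledSecular m τ η X +
      freeSecular τ η X * coupledSlope m τ η η X = 0) : η = 0 ∧ X = 0 := by
  have hT : 0 < 3 * (3 + τ) := by positivity
  have hmτ : 0 < 9 * m * τ ^ 2 := by positivity
  have of_eta : η = 0 → freeSecular τ η X * coupledSecular m τ η X = 0 → η = 0 ∧ X = 0 := by
    intro h0 h
    refine ⟨h0, ?_⟩
    rw [freeSecular, coupledSecular, h0] at h
    simpa using h
  by_cases hf : freeSecular τ η X = 0
  · rw [hf, zero_mul, add_zero] at h'
    refine of_eta ?_ h
    rcases mul_eq_zero.1 h' with h0 | h0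
    · rw [freeSlope] at h0
      rcases mul_eq_zero.1 h0 with h1 | h1 <;> linarith
    · rw [freeSecular] at hf
      rw [coupledSecular, hf, zero_mul, zero_sub, neg_eq_zero] at h0
      exact pow_eq_zero_iff two_ne_zero |>.1 ((mul_eq_zero.1 h0).resolve_left hmτ.ne')
  · have hc := (mul_eq_zero.1 h).resolve_left hf
    rw [hc, mul_zero, zero_add] at h'
    have hs := (mul_eq_zero.1 h').resolve_left hf
    rw [coupledSlope] at hs
    refine of_eta ?_ h
    rcases mul_eq_zero.1 hs with h0 | h0
    · linarith
    · exfalso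
      rw [coupledSecular] at hc
      -- The equation is quadratic in `η ^ 2`; its discriminant is positive.
      have hdisc : (3 * (6 + (m + 1) * τ) * X + 9 * m * τ ^ 2) ^ 2 =
          4 * (9 * (3 + τ) * (3 + m * τ)) * X ^ 2 := by
        linear_combination (9 * (3 + τ) * (3 + m * τ) * (η ^ 2 + η ^ 2) -
            (3 * (6 + (m + 1) * τ) * X + 9 * m * τ ^ 2)) * h0 -
          (4 * (9 * (3 + τ) * (3 + m * τ))) * hc
      have h1 : 0 ≤ 9 * ((m - 1) * τ * X) ^ 2 := by positivity
      have h2 : 0 ≤ 2 * (3 * (6 + (m + 1) * τ) * X) * (9 * m * τ ^ 2) := by positivity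
      have h3 : 0 < (9 * m * τ ^ 2) ^ 2 := by positivity
      nlinarith

/-! ### The function `F` near its zeros -/

/-- The square of the norm `N` of the momentum. -/
def normForm (δ : ℝ × ℝ) : ℝ := δ.1 ^ 2 - δ.1 * δ.2 + δ.2 ^ 2

theorem form_eq_normForm (κ : ℝ) (δ : ℝ × ℝ) : form κ (-κ) κ δ = κ * normForm δ := by
  rw [form, normForm]
  ring

theorem norm_F_sq (θ : ℝ × ℝ) :
    ‖F θ‖ ^ 2 = 3 + 2 * Real.cos θ.1 + 2 * Real.cos θ.2 + 2 * Real.cos (θ.1 - θ.2) := by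
  have e : F θ = ⟨1 + Real.cos θ.1 + Real.cos θ.2, Real.sin θ.1 + Real.sin θ.2⟩ := by
    apply Complex.ext <;> simp [F, Complex.exp_ofReal_mul_I_re, Complex.exp_ofReal_mul_I_im]
  rw [← Complex.normSq_eq_norm_sq, e, Complex.normSq_mk, Real.cos_sub]
  linear_combination Real.sin_sq_add_cos_sq θ.1 + Real.sin_sq_add_cos_sq θ.2

theorem norm_F_sq_le (θ : ℝ × ℝ) : ‖F θ‖ ^ 2 ≤ 9 := by
  rw [norm_F_sq]
  linarith [Real.cos_le_one θ.1, Real.cos_le_one θ.2, Real.cos_le_one (θ.1 - θ.2)]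

theorem continuous_F : Continuous F := by
  unfold F
  fun_prop

theorem norm_F_sq_lt {θ : ℝ × ℝ} (hθ : θ ∈ brillouinZone) (h0 : θ ≠ 0) : ‖F θ‖ ^ 2 < 9 := by
  refine lt_of_le_of_ne (norm_F_sq_le θ) fun h => h0 ?_
  rw [norm_F_sq] at h
  have hpi := Real.pi_pos
  have h1 : Real.cos θ.1 = 1 := by
    linarith [Real.cos_le_one θ.1, Real.cos_le_one θ.2, Real.cos_le_one (θ.1 - θ.2)]
  have h2 : Real.cos θ.2 = 1 := by
    linarith [Real.cos_le_one θ.1, Real.cos_le_one θ.2, Real.cos_le_one (θ.1 - θ.2)]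
  obtain ⟨⟨a1, a2⟩, b1, b2⟩ := hθ
  ext
  · exact (Real.cos_eq_one_iff_of_lt_of_lt (by linarith) (by linarith)).1 h1
  · exact (Real.cos_eq_one_iff_of_lt_of_lt (by linarith) (by linarith)).1 h2

theorem cos_two_pi_div_three : Real.cos (2 * Real.pi / 3) = -(1 / 2) := by
  rw [show 2 * Real.pi / 3 = Real.pi - Real.pi / 3 by ring, Real.cos_pi_sub, Real.cos_pi_div_three]

theorem sin_two_pi_div_three : Real.sin (2 * Real.pi / 3) = √3 / 2 := by
  rw [show 2 * Real.pi / 3 = Real.pi - Real.pi / 3 by ring, Real.sin_pi_sub, Real.sin_pi_div_three]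

theorem mem_diracPoints_of_F_eq_zero {θ : ℝ × ℝ} (hθ : θ ∈ brillouinZone) (h : F θ = 0) :
    θ ∈ diracPoints := by
  have hre : 1 + Real.cos θ.1 + Real.cos θ.2 = 0 := by
    have := congrArg Complex.re h
    simpa [F, Complex.exp_ofReal_mul_I_re] using this
  have him : Real.sin θ.1 + Real.sin θ.2 = 0 := by
    have := congrArg Complex.im h
    simpa [F, Complex.exp_ofReal_mul_I_im] using this
  have hpi := Real.pi_pos
  have e1 := Real.sin_sq_add_cos_sq θ.1
  have e2 := Real.sin_sq_add_cos_sq θ.2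
  have hc1 : Real.cos θ.1 = -(1 / 2) := by
    have h2 : Real.sin θ.2 = -Real.sin θ.1 := by linarith
    have h3 : Real.cos θ.2 = -1 - Real.cos θ.1 := by linarith
    rw [h2, h3] at e2
    nlinarith
  have hc2 : Real.cos θ.2 = -(1 / 2) := by linarith
  have habs : ∀ t : ℝ, -Real.pi ≤ t → t ≤ Real.pi → Real.cos t = -(1 / 2) →
      t = 2 * Real.pi / 3 ∨ t = -(2 * Real.pi / 3) := by
    intro t ht1 ht2 ht
    rw [← Real.cos_abs, ← cos_two_pi_div_three] at ht
    have := Real.injOn_cos ⟨abs_nonneg t, abs_le.2 ⟨ht1, ht2⟩⟩ ⟨by positivity, by linarith⟩ ht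
    exact eq_or_eq_neg_of_abs_eq this
  have hs : 0 < Real.sin (2 * Real.pi / 3) := by
    rw [sin_two_pi_div_three]
    positivity
  obtain ⟨⟨a1, a2⟩, b1, b2⟩ := hθ
  rcases habs _ a1 a2 hc1 with h1 | h1 <;> rcases habs _ b1 b2 hc2 with h2 | h2
  · rw [h1, h2] at him
    linarith
  · exact Or.inl (Prod.ext h1 h2)
  · exact Or.inr (Prod.ext h1 h2)
  · rw [h1, h2, Real.sin_neg] at him
    linarith

theorem abs_fst_sub_snd_le (δ : ℝ × ℝ) : |δ.1| ≤ ‖δ‖ ∧ |δ.2| ≤ ‖δ‖ ∧ |δ.1 - δ.2| ≤ 2 * ‖δ‖ := by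
  have h1 : |δ.1| ≤ ‖δ‖ := norm_fst_le δ
  have h2 : |δ.2| ≤ ‖δ‖ := norm_snd_le δ
  exact ⟨h1, h2, (abs_sub _ _).trans (by linarith)⟩

/-- Taylor expansion of cosine at the angles `± 2 π / 3`, where the sine is `± √3 / 2`. -/
theorem abs_cos_add_sub_le {α σ t : ℝ} (hc : Real.cos α = -(1 / 2)) (hs : Real.sin α = σ)
    (hσ : |σ| ≤ 1) (ht : |t| ≤ 1) :
    |Real.cos (α + t) - (-(1 / 2) - σ * t + t ^ 2 / 4)| ≤ |t| ^ 3 := by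
  have h1 := Real.cos_bound ht
  have h2 := Real.sin_bound ht
  have ht0 := abs_nonneg t
  have h4 : |t| ^ 4 ≤ |t| ^ 3 := pow_le_pow_of_le_one ht0 ht (by norm_num)
  have h5 : |t| ^ 5 ≤ |t| ^ 3 := pow_le_pow_of_le_one ht0 ht (by norm_num)
  have e : Real.cos (α + t) - (-(1 / 2) - σ * t + t ^ 2 / 4) =
      -(1 / 2) * (Real.cos t - (1 - t ^ 2 / 2)) - σ * (Real.sin t - (t - t ^ 3 / 6)) +
        σ * (t ^ 3 / 6) := by
    rw [Real.cos_add, hc, hs]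
    ring
  rw [e]
  refine (abs_add_le _ _).trans ?_
  have a1 := abs_sub (-(1 / 2) * (Real.cos t - (1 - t ^ 2 / 2)))
    (σ * (Real.sin t - (t - t ^ 3 / 6)))
  rw [abs_mul, abs_mul, show |(-(1 / 2) : ℝ)| = 1 / 2 by norm_num [abs_of_neg]] at a1
  have a2 : |σ * (t ^ 3 / 6)| ≤ |t| ^ 3 / 6 := by
    rw [abs_mul, abs_div, abs_pow, abs_of_pos (show (0 : ℝ) < 6 by norm_num)]
    exact mul_le_of_le_one_left (by positivity) hσ
  have a0 : 0 ≤ |t| ^ 3 := by positivity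
  have a3 : |σ| * |Real.sin t - (t - t ^ 3 / 6)| ≤ |t| ^ 5 / 100 :=
    (mul_le_of_le_one_left (abs_nonneg _) hσ).trans h2
  linarith

/-- At the zeros of `F`, the Hessian of `|F| ^ 2` is that of `normForm`. -/
theorem norm_F_sq_sub_normForm_isBigO {θD : ℝ × ℝ} (hθ : θD ∈ diracPoints) :
    (fun θ => ‖F θ‖ ^ 2 - normForm (θ - θD)) =O[𝓝 θD] fun θ => ‖θ - θD‖ ^ 3 := by
  refine Asymptotics.IsBigO.of_bound 20 ?_
  have hball : ∀ᶠ θ in 𝓝 θD, ‖θ - θD‖ < 1 / 2 := by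
    filter_upwards [Metric.ball_mem_nhds θD (show (0 : ℝ) < 1 / 2 by norm_num)] with θ h
    rwa [Metric.mem_ball, dist_eq_norm] at h
  filter_upwards [hball] with θ hδ
  obtain ⟨δ, rfl⟩ : ∃ δ, θ = θD + δ := ⟨θ - θD, by abel⟩
  rw [add_sub_cancel_left] at hδ ⊢
  obtain ⟨b1, b2, b3⟩ := abs_fst_sub_snd_le δ
  have hcubes : |δ.1| ^ 3 ≤ ‖δ‖ ^ 3 ∧ |δ.2| ^ 3 ≤ ‖δ‖ ^ 3 ∧ |δ.1 - δ.2| ^ 3 ≤ (2 * ‖δ‖) ^ 3 :=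
    ⟨by gcongr, by gcongr, by gcongr⟩
  have hs3 : |√3 / 2| ≤ 1 := by
    rw [abs_of_nonneg (by positivity)]
    nlinarith [Real.sq_sqrt (show (0 : ℝ) ≤ 3 by norm_num), Real.sqrt_nonneg 3]
  have hs3' : |-(√3 / 2)| ≤ 1 := by rwa [abs_neg]
  have hcn : Real.cos (-(2 * Real.pi / 3)) = -(1 / 2) := by
    rw [Real.cos_neg, cos_two_pi_div_three]
  have hsn : Real.sin (-(2 * Real.pi / 3)) = -(√3 / 2) := by
    rw [Real.sin_neg, sin_two_pi_div_three]
  have hcp := cos_two_pi_div_three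
  have hsp := sin_two_pi_div_three
  rw [norm_F_sq, Real.norm_eq_abs, Real.norm_eq_abs, abs_of_nonneg (show 0 ≤ ‖δ‖ ^ 3 by positivity),
    normForm]
  simp only [Prod.fst_add, Prod.snd_add]
  -- The difference of the two angles is `± 4 π / 3`, which is `∓ 2 π / 3` modulo `2 π`.
  rcases hθ with rfl | rfl
  · have k1 := abs_le.1 (abs_cos_add_sub_le hcp hsp hs3 (t := δ.1) (by linarith))
    have k2 := abs_le.1 (abs_cos_add_sub_le hcn hsn hs3' (t := δ.2) (by linarith))
    have k3 := abs_le.1 (abs_cos_add_sub_le hcn hsn hs3' (t := δ.1 - δ.2) (by linarith))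
    have e : 2 * Real.pi / 3 + δ.1 - (-(2 * Real.pi / 3) + δ.2) =
        -(2 * Real.pi / 3) + (δ.1 - δ.2) + 2 * Real.pi := by ring
    rw [e, Real.cos_add_two_pi, abs_le]
    constructor <;> linarith
  · have k1 := abs_le.1 (abs_cos_add_sub_le hcn hsn hs3' (t := δ.1) (by linarith))
    have k2 := abs_le.1 (abs_cos_add_sub_le hcp hsp hs3 (t := δ.2) (by linarith))
    have k3 := abs_le.1 (abs_cos_add_sub_le hcp hsp hs3 (t := δ.1 - δ.2) (by linarith))
    have e : -(2 * Real.pi / 3) + δ.1 - (2 * Real.pi / 3 + δ.2) =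
        2 * Real.pi / 3 + (δ.1 - δ.2) - 2 * Real.pi := by ring
    rw [e, Real.cos_sub_two_pi, abs_le]
    constructor <;> linarith

theorem F_eq_zero_of_mem_diracPoints {θD : ℝ × ℝ} (hθ : θD ∈ diracPoints) : F θD = 0 := by
  obtain ⟨C, hC⟩ := (norm_F_sq_sub_normForm_isBigO hθ).bound
  have := hC.self_of_nhds
  simpa [normForm] using this

theorem normForm_bounds (δ : ℝ × ℝ) : ‖δ‖ ^ 2 / 2 ≤ normForm δ ∧ normForm δ ≤ 3 * ‖δ‖ ^ 2 := by
  have h1 : |δ.1| ≤ ‖δ‖ := norm_fst_le δ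
  have h2 : |δ.2| ≤ ‖δ‖ := norm_snd_le δ
  rw [normForm]
  constructor
  · rcases max_choice |δ.1| |δ.2| with h | h
    · rw [show ‖δ‖ = |δ.1| from h, sq_abs]
      nlinarith [sq_nonneg (δ.1 - 2 * δ.2)]
    · rw [show ‖δ‖ = |δ.2| from h, sq_abs]
      nlinarith [sq_nonneg (2 * δ.1 - δ.2)]
  · have a1 : δ.1 ^ 2 ≤ ‖δ‖ ^ 2 := by rw [← sq_abs]; gcongr
    have a2 : δ.2 ^ 2 ≤ ‖δ‖ ^ 2 := by rw [← sq_abs]; gcongr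
    nlinarith [sq_nonneg (δ.1 + δ.2)]

theorem norm_sub_pow_isBigO (θD : ℝ × ℝ) {j k : ℕ} (hjk : j ≤ k) :
    (fun θ : ℝ × ℝ => ‖θ - θD‖ ^ k) =O[𝓝 θD] fun θ => ‖θ - θD‖ ^ j := by
  refine Asymptotics.IsBigO.of_bound 1 ?_
  filter_upwards [Metric.ball_mem_nhds θD one_pos] with θ h
  rw [Metric.mem_ball, dist_eq_norm] at h
  rw [norm_pow, norm_pow, norm_norm, one_mul]
  exact pow_le_pow_of_le_one (norm_nonneg _) h.le hjk

theorem norm_F_sq_isBigO {θD : ℝ × ℝ} (hθ : θD ∈ diracPoints) :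
    (fun θ => ‖F θ‖ ^ 2) =O[𝓝 θD] fun θ => ‖θ - θD‖ ^ 2 := by
  have h1 : (fun θ => normForm (θ - θD)) =O[𝓝 θD] fun θ => ‖θ - θD‖ ^ 2 := by
    refine Asymptotics.IsBigO.of_bound 3 (Eventually.of_forall fun θ => ?_)
    obtain ⟨a, b⟩ := normForm_bounds (θ - θD)
    rw [Real.norm_eq_abs, Real.norm_eq_abs, abs_of_nonneg (by positivity : 0 ≤ ‖θ - θD‖ ^ 2),
      abs_of_nonneg (le_trans (by positivity) a)]
    exact b
  have h2 : (fun θ : ℝ × ℝ => ‖θ - θD‖ ^ 3) =O[𝓝 θD] fun θ => ‖θ - θD‖ ^ 2 :=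
    norm_sub_pow_isBigO θD (by norm_num)
  simpa using ((norm_F_sq_sub_normForm_isBigO hθ).trans h2).add h1

/-! ### Absence of Dirac cones -/

theorem exists_form_ge {a b c : ℝ} (ha : 0 < a) (hb : b ^ 2 < 4 * a * c) :
    ∃ k : ℝ, 0 < k ∧ ∀ δ : ℝ × ℝ, (k * ‖δ‖) ^ 2 ≤ form a b c δ := by
  have hc : 0 < c := by nlinarith [sq_nonneg b]
  set d := 4 * a * c - b ^ 2 with hd
  have hd0 : 0 < d := by linarith
  have hk : 0 < d / (4 * (a + c)) := by positivity
  refine ⟨√(d / (4 * (a + c))), Real.sqrt_pos.2 hk, fun δ => ?_⟩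
  rw [mul_pow, Real.sq_sqrt hk.le, div_mul_eq_mul_div, div_le_iff₀ (by positivity), form]
  have h1 : d * δ.1 ^ 2 ≤ 4 * c * (a * δ.1 ^ 2 + b * (δ.1 * δ.2) + c * δ.2 ^ 2) := by
    nlinarith [sq_nonneg (b * δ.1 + 2 * c * δ.2)]
  have h2 : d * δ.2 ^ 2 ≤ 4 * a * (a * δ.1 ^ 2 + b * (δ.1 * δ.2) + c * δ.2 ^ 2) := by
    nlinarith [sq_nonneg (2 * a * δ.1 + b * δ.2)]
  have p1 : 0 ≤ d * δ.1 ^ 2 := by positivity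
  have p2 : 0 ≤ d * δ.2 ^ 2 := by positivity
  rcases max_choice |δ.1| |δ.2| with h | h
  · rw [show ‖δ‖ = |δ.1| from h, sq_abs]
    have : 0 ≤ 4 * a * (a * δ.1 ^ 2 + b * (δ.1 * δ.2) + c * δ.2 ^ 2) := p2.trans h2
    linarith
  · rw [show ‖δ‖ = |δ.2| from h, sq_abs]
    have : 0 ≤ 4 * c * (a * δ.1 ^ 2 + b * (δ.1 * δ.2) + c * δ.2 ^ 2) := p1.trans h1
    linarith

theorem tendsto_of_isBigO_add {θD : ℝ × ℝ} {f g : ℝ × ℝ → ℝ} {y : ℝ} {k : ℕ} (hk : k ≠ 0)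
    (hg : Tendsto g (𝓝 θD) (𝓝 0))
    (h : (fun θ => f θ - (y + g θ)) =O[𝓝 θD] fun θ => ‖θ - θD‖ ^ k) :
    Tendsto f (𝓝 θD) (𝓝 y) := by
  have h0 : Tendsto (fun θ : ℝ × ℝ => ‖θ - θD‖ ^ k) (𝓝 θD) (𝓝 0) :=
    Continuous.tendsto' (by fun_prop) _ _ (by simp [hk])
  simpa using (h.trans_tendsto h0).add ((tendsto_const_nhds (x := y)).add hg)

/-- The branches of a cone are continuous at the apex, and they move away from it linearly. -/
theorem DiracBranches.separation {S : Set ((ℝ × ℝ) × ℝ)} {θD : ℝ × ℝ} {lamD a b c : ℝ}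
    {lm lp : ℝ × ℝ → ℝ} (h : DiracBranches S θD lamD a b c lm lp) :
    Tendsto lm (𝓝 θD) (𝓝 lamD) ∧ Tendsto lp (𝓝 θD) (𝓝 lamD) ∧
      ∃ k : ℝ, 0 < k ∧ ∀ᶠ θ in 𝓝 θD, lm θ ≤ lamD - k * ‖θ - θD‖ ∧
        lamD + k * ‖θ - θD‖ ≤ lp θ := by
  obtain ⟨ha, hb, -, hp, hm⟩ := h
  have hg : Tendsto (fun θ => √(form a b c (θ - θD))) (𝓝 θD) (𝓝 0) :=
    Continuous.tendsto' (by unfold form; fun_prop) _ _ (by simp [form])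
  have hm' : (fun θ => lm θ - (lamD + -√(form a b c (θ - θD)))) =O[𝓝 θD]
      fun θ => ‖θ - θD‖ ^ 2 := by simpa only [sub_eq_add_neg] using hm
  refine ⟨tendsto_of_isBigO_add two_ne_zero (by simpa using hg.neg) hm',
    tendsto_of_isBigO_add two_ne_zero hg hp, ?_⟩
  obtain ⟨k, hk, hform⟩ := exists_form_ge ha hb
  obtain ⟨C₁, hC₁, h₁⟩ := hp.exists_pos
  obtain ⟨C₂, hC₂, h₂⟩ := hm.exists_pos
  refine ⟨k / 2, by positivity, ?_⟩
  have hsmall : ∀ᶠ θ in 𝓝 θD, (C₁ + C₂) * ‖θ - θD‖ < k / 2 := by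
    have : Tendsto (fun θ : ℝ × ℝ => (C₁ + C₂) * ‖θ - θD‖) (𝓝 θD) (𝓝 0) :=
      Continuous.tendsto' (by fun_prop) _ _ (by simp)
    exact this.eventually_lt_const (by positivity)
  filter_upwards [h₁.bound, h₂.bound, hsmall] with θ b₁ b₂ hs
  have hs' : k * ‖θ - θD‖ ≤ √(form a b c (θ - θD)) := Real.le_sqrt_of_sq_le (hform _)
  have hr := norm_nonneg (θ - θD)
  rw [norm_pow, norm_norm, Real.norm_eq_abs] at b₁ b₂
  have e₁ := abs_le.1 b₁
  have e₂ := abs_le.1 b₂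
  have q₁ : C₁ * ‖θ - θD‖ ^ 2 ≤ k / 2 * ‖θ - θD‖ := by nlinarith
  have q₂ : C₂ * ‖θ - θD‖ ^ 2 ≤ k / 2 * ‖θ - θD‖ := by nlinarith
  constructor
  · linarith [e₂.2]
  · linarith [e₁.1]

section Cones

variable {n : ℕ} [NeZero n] {t₀ : ℝ} {q₀ : ℝ → ℝ} {c c₁ s s₁ : ℝ → ℝ → ℝ}

/-- Away from the Dirichlet spectrum, the dispersion relation satisfies the product of the two
secular equations. -/
theorem IsFundamentalSystem.secular_product (h : IsFundamentalSystem q₀ c c₁ s s₁)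
    (hq₀ : ContinuousOn q₀ (Icc (0 : ℝ) 1)) (heven : ∀ x ∈ Icc (0 : ℝ) 1, q₀ (1 - x) = q₀ x)
    (ht₀ : 0 < t₀) {θ : ℝ × ℝ} {lam : ℝ} (hs : s lam 1 ≠ 0)
    (hmem : (θ, lam) ∈ dispersionRelation n t₀ q₀) :
    freeSecular (t₀ ^ 2) (c lam 1) (‖F θ‖ ^ 2) *
      coupledSecular (n - 1 : ℕ) (t₀ ^ 2) (c lam 1) (‖F θ‖ ^ 2) = 0 := by
  obtain ⟨a, b, hab, hV⟩ := h.exists_vertexSystem hq₀ heven ht₀ hs hmem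
  rcases hV.secular ht₀ hab with h0 | ⟨h0, -⟩
  · rw [h0, mul_zero]
  · rw [h0, zero_mul]

/-- With two layers, only the coupled modes exist. -/
theorem IsFundamentalSystem.secular_two (h : IsFundamentalSystem q₀ c c₁ s s₁)
    (hq₀ : ContinuousOn q₀ (Icc (0 : ℝ) 1)) (heven : ∀ x ∈ Icc (0 : ℝ) 1, q₀ (1 - x) = q₀ x)
    (ht₀ : 0 < t₀) {θ : ℝ × ℝ} {lam : ℝ} (hs : s lam 1 ≠ 0)
    (hmem : (θ, lam) ∈ dispersionRelation 2 t₀ q₀) :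
    coupledSecular 1 (t₀ ^ 2) (c lam 1) (‖F θ‖ ^ 2) = 0 := by
  obtain ⟨a, b, hab, hV⟩ := h.exists_vertexSystem hq₀ heven ht₀ hs hmem
  rcases hV.secular ht₀ hab with h0 | ⟨-, v, hv, hsum⟩
  · simpa using h0
  · exfalso
    have huniq : ∀ k : {i : Fin 2 // i ≠ 1}, k = ⟨0, by decide⟩ := by decide
    refine hv (funext fun k => ?_)
    rw [Finset.sum_eq_single k (fun j _ hj => absurd ((huniq j).trans (huniq k).symm) hj)
      (by simp)] at hsum
    exact hsum

/-- A Dirac cone forces a double zero of the secular equations. The two branches have different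
values of the discriminant, since the discriminant is locally injective at the apex, so the
difference quotient of the secular function between them vanishes; in the limit this is a double
zero. An apex in the Dirichlet spectrum would make the secular functions vanish at `η = ± 1`,
which happens only for `θ = 0`. -/
theorem IsFundamentalSystem.of_hasDiracCone (h : IsFundamentalSystem q₀ c c₁ s s₁)
    (hq₀ : ContinuousOn q₀ (Icc (0 : ℝ) 1)) (heven : ∀ x ∈ Icc (0 : ℝ) 1, q₀ (1 - x) = q₀ x)
    (ht₀ : 0 < t₀) (hn : 2 ≤ n) {θD : ℝ × ℝ} (hθ : θD ∈ brillouinZone) {lamD : ℝ}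
    (hgen : θD ≠ 0 ∨ lamD ∉ dirichletSpectrum q₀)
    (hcone : HasDiracCone (dispersionRelation n t₀ q₀) θD lamD) :
    F θD = 0 ∧ c lamD 1 = 0 := by
  obtain ⟨qa, qb, qc, lm, lp, hbr⟩ := hcone
  obtain ⟨hlm, hlp, k, hk, hsep⟩ := hbr.separation
  have hmem := hbr.2.2.1
  set τ := t₀ ^ 2 with hτ
  have hτ0 : 0 < τ := by positivity
  set m : ℝ := ((n - 1 : ℕ) : ℝ) with hm
  have hm0 : 0 < m := by
    rw [hm]
    exact_mod_cast (show 0 < n - 1 by omega)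
  have hX : Tendsto (fun θ => ‖F θ‖ ^ 2) (𝓝[≠] θD) (𝓝 (‖F θD‖ ^ 2)) :=
    ((continuous_F.norm.pow 2).tendsto θD).mono_left nhdsWithin_le_nhds
  have hlm' := hlm.mono_left (nhdsWithin_le_nhds (s := {θD}ᶜ))
  have hlp' := hlp.mono_left (nhdsWithin_le_nhds (s := {θD}ᶜ))
  have hηm : Tendsto (fun θ => c (lm θ) 1) (𝓝[≠] θD) (𝓝 (c lamD 1)) :=
    ((h.continuous_cos_one hq₀).tendsto lamD).comp hlm'
  have hηp : Tendsto (fun θ => c (lp θ) 1) (𝓝[≠] θD) (𝓝 (c lamD 1)) :=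
    ((h.continuous_cos_one hq₀).tendsto lamD).comp hlp'
  have hstrict : ∀ᶠ θ in 𝓝[≠] θD, lm θ < lamD ∧ lamD < lp θ := by
    filter_upwards [hsep.filter_mono nhdsWithin_le_nhds, self_mem_nhdsWithin] with θ hθ' hne
    have : 0 < k * ‖θ - θD‖ := mul_pos hk (norm_pos_iff.2 (sub_ne_zero.2 hne))
    constructor <;> linarith [hθ'.1, hθ'.2]
  have hsm : ∀ᶠ θ in 𝓝[≠] θD, s (lm θ) 1 ≠ 0 :=
    (tendsto_nhdsWithin_iff.2 ⟨hlm', hstrict.mono fun θ h => h.1.ne⟩).eventually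
      (h.eventually_sin_one_ne_zero hq₀ heven lamD)
  have hsp : ∀ᶠ θ in 𝓝[≠] θD, s (lp θ) 1 ≠ 0 :=
    (tendsto_nhdsWithin_iff.2 ⟨hlp', hstrict.mono fun θ h => h.2.ne'⟩).eventually
      (h.eventually_sin_one_ne_zero hq₀ heven lamD)
  have hPm : ∀ᶠ θ in 𝓝[≠] θD, freeSecular τ (c (lm θ) 1) (‖F θ‖ ^ 2) *
      coupledSecular m τ (c (lm θ) 1) (‖F θ‖ ^ 2) = 0 := by
    filter_upwards [hsm, hmem.filter_mono nhdsWithin_le_nhds] with θ h1 h2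
    exact h.secular_product hq₀ heven ht₀ h1 h2.1
  have hPp : ∀ᶠ θ in 𝓝[≠] θD, freeSecular τ (c (lp θ) 1) (‖F θ‖ ^ 2) *
      coupledSecular m τ (c (lp θ) 1) (‖F θ‖ ^ 2) = 0 := by
    filter_upwards [hsp, hmem.filter_mono nhdsWithin_le_nhds] with θ h1 h2
    exact h.secular_product hq₀ heven ht₀ h1 h2.2
  have hfree : Tendsto (fun θ => freeSecular τ (c (lp θ) 1) (‖F θ‖ ^ 2)) (𝓝[≠] θD)
      (𝓝 (freeSecular τ (c lamD 1) (‖F θD‖ ^ 2))) :=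
    hX.sub ((hηp.pow 2).const_mul _)
  have hcoup : ∀ l : ℝ × ℝ → ℝ, Tendsto (fun θ => c (l θ) 1) (𝓝[≠] θD) (𝓝 (c lamD 1)) →
      Tendsto (fun θ => coupledSecular m τ (c (l θ) 1) (‖F θ‖ ^ 2)) (𝓝[≠] θD)
        (𝓝 (coupledSecular m τ (c lamD 1) (‖F θD‖ ^ 2))) := fun l hl =>
    ((hX.sub ((hl.pow 2).const_mul _)).mul (hX.sub ((hl.pow 2).const_mul _))).sub
      ((hl.pow 2).const_mul _)
  have hP : freeSecular τ (c lamD 1) (‖F θD‖ ^ 2) *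
      coupledSecular m τ (c lamD 1) (‖F θD‖ ^ 2) = 0 :=
    tendsto_nhds_unique (hfree.mul (hcoup lp hηp))
      (tendsto_const_nhds.congr' (hPp.mono fun θ h => h.symm))
  by_cases hsD : s lamD 1 = 0
  · exfalso
    have hη := h.cos_one_sq heven hsD
    have hX9 := norm_F_sq_lt hθ (hgen.resolve_right fun h' => h' (h.mem_dirichletSpectrum hq₀ hsD))
    exact mul_ne_zero (freeSecular_ne_zero hτ0 hη hX9) (coupledSecular_ne_zero hm0 hτ0 hη hX9) hP
  · have hle : c lamD 1 ^ 2 ≤ 1 := by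
      rcases mul_eq_zero.1 hP with h0 | h0
      · exact sq_le_one_of_freeSecular hτ0 (norm_F_sq_le _) h0
      · exact sq_le_one_of_coupledSecular hm0 hτ0 (norm_F_sq_le _) h0
    have hne : ∀ᶠ θ in 𝓝[≠] θD, c (lp θ) 1 ≠ c (lm θ) 1 := by
      filter_upwards [(hlp'.prodMk hlm').eventually (h.eventually_cos_one_ne hq₀ heven hsD hle),
        hstrict] with θ h1 h2
      exact h1 (h2.1.trans h2.2).ne'
    have hslope : Tendsto (fun θ => freeSlope τ (c (lp θ) 1) (c (lm θ) 1) *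
        coupledSecular m τ (c (lm θ) 1) (‖F θ‖ ^ 2) +
        freeSecular τ (c (lp θ) 1) (‖F θ‖ ^ 2) *
          coupledSlope m τ (c (lp θ) 1) (c (lm θ) 1) (‖F θ‖ ^ 2)) (𝓝[≠] θD)
        (𝓝 (freeSlope τ (c lamD 1) (c lamD 1) * coupledSecular m τ (c lamD 1) (‖F θD‖ ^ 2) +
          freeSecular τ (c lamD 1) (‖F θD‖ ^ 2) *
            coupledSlope m τ (c lamD 1) (c lamD 1) (‖F θD‖ ^ 2))) :=
      (((hηp.add hηm).const_mul _).mul (hcoup lm hηm)).add (hfree.mul ((hηp.add hηm).mul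
        ((((hηp.pow 2).add (hηm.pow 2)).const_mul _).sub
          ((hX.const_mul _).add tendsto_const_nhds))))
    have hzero := tendsto_nhds_unique hslope (tendsto_const_nhds.congr' (f₁ := fun _ => (0 : ℝ)) (by
      filter_upwards [hPm, hPp, hne] with θ h1 h2 h3
      refine ((mul_eq_zero.1 (?_ : (c (lp θ) 1 - c (lm θ) 1) * _ = 0)).resolve_left
        (sub_ne_zero.2 h3)).symm
      linear_combination h2 - h1 -
        coupledSecular m τ (c (lm θ) 1) (‖F θ‖ ^ 2) *
          freeSecular_sub τ (c (lp θ) 1) (c (lm θ) 1) (‖F θ‖ ^ 2) -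
        freeSecular τ (c (lp θ) 1) (‖F θ‖ ^ 2) *
          coupledSecular_sub m τ (c (lp θ) 1) (c (lm θ) 1) (‖F θ‖ ^ 2)))
    obtain ⟨h1, h2⟩ := eq_zero_of_double_zero hm0 hτ0 (by positivity) hP hzero
    exact ⟨by simpa using h2, h1⟩

/-- Near a zero of the discriminant, the discriminant grows at least linearly. -/
theorem IsFundamentalSystem.exists_abs_sub_le (h : IsFundamentalSystem q₀ c c₁ s s₁)
    (hq₀ : ContinuousOn q₀ (Icc (0 : ℝ) 1)) (heven : ∀ x ∈ Icc (0 : ℝ) 1, q₀ (1 - x) = q₀ x)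
    {M : ℝ} (hM : c M 1 = 0) :
    ∃ C : ℝ, 0 < C ∧ ∀ᶠ lam in 𝓝 M, |lam - M| ≤ C * |c lam 1| := by
  have hsM : s M 1 ≠ 0 := by
    intro hs
    have := h.cos_one_sq heven hs
    rw [hM] at this
    norm_num at this
  obtain ⟨B, -, hB⟩ := h.exists_integral_sin_sub_le hq₀ M
  have hJ := h.integral_sin_sq_pos M
  set J := ∫ x in (0 : ℝ)..1, s M x * s M x
  have hev := ((tendsto_prod_of_abs_sub_le hB).comp
    ((tendsto_id (x := 𝓝 M)).prodMk tendsto_const_nhds)).eventually_const_lt (half_lt_self hJ)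
  refine ⟨|s M 1| / (J / 2), div_pos (abs_pos.2 hsM) (half_pos hJ), ?_⟩
  filter_upwards [hev] with lam hl
  simp only [Function.comp, id] at hl
  have := h.sin_sub_cos_identity heven lam M
  rw [hM, mul_zero, zero_sub] at this
  have habs := congrArg abs this
  rw [abs_neg, abs_mul, abs_mul, abs_of_pos ((half_pos hJ).trans hl)] at habs
  rw [div_mul_eq_mul_div, le_div_iff₀ (half_pos hJ)]
  nlinarith [abs_nonneg (lam - M)]

/-- At zeros of `F`, the coupled modes have bands that touch too smoothly for a cone: the secular
equation gives `η = O(|F| ^ 2)`. -/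
theorem coupledSecular_small {m τ : ℝ} (hm : 0 < m) (hτ : 0 < τ) :
    ∀ᶠ p in 𝓝 ((0 : ℝ), (0 : ℝ)), coupledSecular m τ p.1 p.2 = 0 → 0 ≤ p.2 →
      m * τ ^ 2 * p.1 ^ 2 ≤ p.2 ^ 2 := by
  have hpos : 0 < 8 * m * τ ^ 2 := by positivity
  have hcont : Continuous fun p : ℝ × ℝ => 9 * (3 + τ) * (3 + m * τ) * p.1 ^ 2 := by fun_prop
  have hev := (hcont.tendsto' (0, 0) 0 (by simp)).eventually_lt_const hpos
  filter_upwards [hev] with p hp h0 hX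
  rw [coupledSecular] at h0
  have h1 : 0 ≤ 3 * (6 + (m + 1) * τ) * p.2 * p.1 ^ 2 := by positivity
  have h2 := mul_le_mul_of_nonneg_right hp.le (sq_nonneg p.1)
  nlinarith

theorem IsFundamentalSystem.not_hasDiracCone_two (h : IsFundamentalSystem q₀ c c₁ s s₁)
    (hq₀ : ContinuousOn q₀ (Icc (0 : ℝ) 1)) (heven : ∀ x ∈ Icc (0 : ℝ) 1, q₀ (1 - x) = q₀ x)
    (ht₀ : 0 < t₀) {θD : ℝ × ℝ} (hθ : θD ∈ brillouinZone) {lamD : ℝ}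
    (hgen : θD ≠ 0 ∨ lamD ∉ dirichletSpectrum q₀) :
    ¬ HasDiracCone (dispersionRelation 2 t₀ q₀) θD lamD := by
  intro hcone
  obtain ⟨hF, hη⟩ := h.of_hasDiracCone hq₀ heven ht₀ le_rfl hθ hgen hcone
  obtain ⟨qa, qb, qc, lm, lp, hbr⟩ := hcone
  obtain ⟨-, hlp, k, hk, hsep⟩ := hbr.separation
  have hmem := hbr.2.2.1
  have hτ0 : 0 < t₀ ^ 2 := by positivity
  obtain ⟨C, hC, hlin⟩ := h.exists_abs_sub_le hq₀ heven hη
  have hsD : s lamD 1 ≠ 0 := by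
    intro hs
    have := h.cos_one_sq heven hs
    rw [hη] at this
    norm_num at this
  have hsp : ∀ᶠ θ in 𝓝 θD, s (lp θ) 1 ≠ 0 :=
    (((h.continuous_sin_one hq₀).tendsto lamD).comp hlp).eventually_ne hsD
  have hηp : Tendsto (fun θ => c (lp θ) 1) (𝓝 θD) (𝓝 0) := by
    have := ((h.continuous_cos_one hq₀).tendsto lamD).comp hlp
    rwa [hη] at this
  have hX : Tendsto (fun θ => ‖F θ‖ ^ 2) (𝓝 θD) (𝓝 0) :=
    (continuous_F.norm.pow 2).tendsto' _ _ (by simp [hF])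
  have hsmall := (hηp.prodMk_nhds hX).eventually (coupledSecular_small one_pos hτ0)
  obtain ⟨D, hD, hXO⟩ := (norm_F_sq_isBigO (mem_diracPoints_of_F_eq_zero hθ hF)).exists_pos
  have hr : ∀ᶠ θ in 𝓝 θD, C * D * ‖θ - θD‖ < k * t₀ ^ 2 := by
    have : Tendsto (fun θ : ℝ × ℝ => C * D * ‖θ - θD‖) (𝓝 θD) (𝓝 0) :=
      Continuous.tendsto' (by fun_prop) _ _ (by simp)
    exact this.eventually_lt_const (by positivity)
  have hall : ∀ᶠ θ in 𝓝[≠] θD, False := by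
    filter_upwards [hsep.filter_mono nhdsWithin_le_nhds, hmem.filter_mono nhdsWithin_le_nhds,
      hsp.filter_mono nhdsWithin_le_nhds, hsmall.filter_mono nhdsWithin_le_nhds,
      hXO.bound.filter_mono nhdsWithin_le_nhds, hr.filter_mono nhdsWithin_le_nhds,
      (hlp.eventually hlin).filter_mono nhdsWithin_le_nhds, self_mem_nhdsWithin]
      with θ a1 a2 a3 a4 a5 a6 a7 hne
    have hr0 : 0 < ‖θ - θD‖ := norm_pos_iff.2 (sub_ne_zero.2 hne)
    have b1 := a4 (h.secular_two hq₀ heven ht₀ a3 a2.2) (by positivity)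
    have b2 : t₀ ^ 2 * |c (lp θ) 1| ≤ ‖F θ‖ ^ 2 := by
      refine abs_le_of_sq_le_sq' ?_ (by positivity) |>.2
      rw [mul_pow, sq_abs]
      simpa using b1
    rw [norm_pow, norm_norm, norm_pow, norm_norm] at a5
    have b3 : k * ‖θ - θD‖ ≤ C * |c (lp θ) 1| := by
      refine le_trans ?_ ((le_abs_self _).trans a7)
      linarith [a1.2]
    have b4 : k * t₀ ^ 2 * ‖θ - θD‖ ≤ C * D * ‖θ - θD‖ * ‖θ - θD‖ := by
      calc k * t₀ ^ 2 * ‖θ - θD‖ = t₀ ^ 2 * (k * ‖θ - θD‖) := by ring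
        _ ≤ t₀ ^ 2 * (C * |c (lp θ) 1|) := mul_le_mul_of_nonneg_left b3 hτ0.le
        _ = C * (t₀ ^ 2 * |c (lp θ) 1|) := by ring
        _ ≤ C * (D * ‖θ - θD‖ ^ 2) := mul_le_mul_of_nonneg_left (b2.trans a5) hC.le
        _ = C * D * ‖θ - θD‖ * ‖θ - θD‖ := by ring
    exact absurd (le_of_mul_le_mul_right b4 hr0) (not_le.2 a6)
  exact hall.exists.elim fun _ h => h

end Cones

/-! ### Construction of the branches -/

section Branches

variable {n : ℕ} [NeZero n] {t₀ : ℝ} {q₀ : ℝ → ℝ} {c c₁ s s₁ : ℝ → ℝ → ℝ}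

/-- The branches are obtained by composing a local inverse of the discriminant with a positive and
a negative solution `± w` of a secular equation, which is supposed to have the leading term `ω`.
The last conjunct records that half the discriminant equals `± ε w` on them. -/
theorem IsFundamentalSystem.exists_touchingBranches (h : IsFundamentalSystem q₀ c c₁ s s₁)
    (hq₀ : ContinuousOn q₀ (Icc (0 : ℝ) 1)) (heven : ∀ x ∈ Icc (0 : ℝ) 1, q₀ (1 - x) = q₀ x)
    (ht₀ : 0 < t₀) {lamD : ℝ} (hD : c lamD 1 = 0) :
    ∃ β : ℝ, 0 < β ∧ ∀ (w ω : ℝ × ℝ → ℝ) (k : ℕ) (θD : ℝ × ℝ), Tendsto w (𝓝 θD) (𝓝 0) →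
      (∀ᶠ θ in 𝓝 θD, ∀ η : ℝ, η ^ 2 = w θ ^ 2 → ∃ a b : Fin n → ℂ, ¬ (a = 0 ∧ b = 0) ∧
        VertexSystem n t₀ θ (η : ℂ) a b) →
      (fun θ => w θ - ω (θ - θD)) =O[𝓝 θD] (fun θ => ‖θ - θD‖ ^ k) →
      (fun θ => w θ ^ 2) =O[𝓝 θD] (fun θ => ‖θ - θD‖ ^ k) →
      ∃ lm lp : ℝ × ℝ → ℝ,
        TouchingBranches (dispersionRelation n t₀ q₀) θD lamD (fun δ => β * ω δ) k lm lp ∧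
        ∃ ε : ℝ, (ε = 1 ∨ ε = -1) ∧
          ∀ᶠ θ in 𝓝 θD, c (lp θ) 1 = ε * w θ ∧ c (lm θ) 1 = -ε * w θ := by
  obtain ⟨ε, hε, β, hβ, l, C, hC, hl⟩ := h.exists_local_inverse hq₀ heven hD
  refine ⟨β, hβ, fun w ω k θD hw hV hω hw2 => ?_⟩
  have hw' : Tendsto (fun θ => -w θ) (𝓝 θD) (𝓝 0) := by simpa using hw.neg
  have hε2 : ε ^ 2 = 1 := by rcases hε with rfl | rfl <;> norm_num
  have hw1 : ∀ᶠ θ in 𝓝 θD, w θ ^ 2 < 1 :=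
    (show Tendsto (fun θ => w θ ^ 2) (𝓝 θD) (𝓝 0) by simpa using hw.pow 2).eventually_lt_const
      one_pos
  have hmem : ∀ f : ℝ × ℝ → ℝ, (∀ θ, f θ ^ 2 = w θ ^ 2) → Tendsto f (𝓝 θD) (𝓝 0) →
      ∀ᶠ θ in 𝓝 θD, (θ, l (f θ)) ∈ dispersionRelation n t₀ q₀ := by
    intro f hf hf0
    filter_upwards [hf0.eventually hl, hV, hw1] with θ h1 h2 h3
    have hsq : c (l (f θ)) 1 ^ 2 = w θ ^ 2 := by rw [h1.1, mul_pow, hε2, one_mul, hf]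
    obtain ⟨a, b, hab, hV'⟩ := h2 _ hsq
    refine h.mem_dispersionRelation hq₀ heven ht₀ (fun hs => ?_) hab hV'
    have := h.cos_one_sq heven hs
    linarith
  have hO : ∀ f : ℝ × ℝ → ℝ, (∀ θ, f θ ^ 2 = w θ ^ 2) → Tendsto f (𝓝 θD) (𝓝 0) →
      (fun θ => l (f θ) - (lamD + β * f θ)) =O[𝓝 θD] fun θ => ‖θ - θD‖ ^ k := by
    intro f hf hf0
    refine Asymptotics.IsBigO.trans (Asymptotics.IsBigO.of_bound C ?_) hw2
    filter_upwards [hf0.eventually hl] with θ h1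
    rw [Real.norm_eq_abs, Real.norm_eq_abs, abs_of_nonneg (sq_nonneg (w θ)), ← hf]
    exact h1.2
  refine ⟨fun θ => l (-w θ), fun θ => l (w θ), ⟨?_, ?_, ?_⟩, ε, hε, ?_⟩
  · filter_upwards [hmem _ (fun θ => by ring) hw', hmem _ (fun θ => rfl) hw] with θ h1 h2
    exact ⟨h1, h2⟩
  · refine ((hO w (fun _ => rfl) hw).add (hω.const_mul_left β)).congr_left fun θ => ?_
    ring
  · refine ((hO (fun θ => -w θ) (fun _ => by ring) hw').sub
      (hω.const_mul_left β)).congr_left fun θ => ?_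
    ring
  · filter_upwards [hw.eventually hl, hw'.eventually hl] with θ h1 h2
    exact ⟨h1.1, by rw [h2.1]; ring⟩

/-- The small positive solution of the coupled secular equation is `η = X * coupledRoot m τ X`; this
is the quadratic formula for `η ^ 2`, with the root of the discriminant in the denominator. -/
noncomputable def coupledRoot (m τ X : ℝ) : ℝ :=
  √(2 / ((3 * (6 + (m + 1) * τ) * X + 9 * m * τ ^ 2) +
    √((3 * (6 + (m + 1) * τ) * X + 9 * m * τ ^ 2) ^ 2 -
      4 * (9 * (3 + τ) * (3 + m * τ)) * X ^ 2)))

theorem coupledSecular_of_sq_eq {m τ η X : ℝ} (hm : 0 < m) (hτ : 0 < τ) (hX : 0 ≤ X)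
    (hη : η ^ 2 = (X * coupledRoot m τ X) ^ 2) : coupledSecular m τ η X = 0 := by
  set b := 3 * (6 + (m + 1) * τ) * X + 9 * m * τ ^ 2 with hb
  have hb0 : 0 < b := by positivity
  have hdisc : 0 ≤ b ^ 2 - 4 * (9 * (3 + τ) * (3 + m * τ)) * X ^ 2 := by
    have e : b ^ 2 - 4 * (9 * (3 + τ) * (3 + m * τ)) * X ^ 2 = 9 * ((m - 1) * τ * X) ^ 2 +
        2 * (3 * (6 + (m + 1) * τ) * X) * (9 * m * τ ^ 2) + (9 * m * τ ^ 2) ^ 2 := by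
      rw [hb]
      ring
    rw [e]
    positivity
  rw [coupledRoot, mul_pow, Real.sq_sqrt (by positivity)] at hη
  set d := √(b ^ 2 - 4 * (9 * (3 + τ) * (3 + m * τ)) * X ^ 2) with hd
  have hd2 : d ^ 2 = b ^ 2 - 4 * (9 * (3 + τ) * (3 + m * τ)) * X ^ 2 := Real.sq_sqrt hdisc
  have hd0 : 0 ≤ d := Real.sqrt_nonneg _
  have e : coupledSecular m τ η X =
      9 * (3 + τ) * (3 + m * τ) * (η ^ 2) ^ 2 - b * η ^ 2 + X ^ 2 := by
    rw [coupledSecular, hb]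
    ring
  rw [e, hη]
  field_simp
  linear_combination X ^ 2 * hd2

theorem coupledRoot_zero_pos {m τ : ℝ} (hm : 0 < m) (hτ : 0 < τ) : 0 < coupledRoot m τ 0 := by
  rw [coupledRoot]
  positivity

theorem differentiableAt_coupledRoot {m τ : ℝ} (hm : 0 < m) (hτ : 0 < τ) :
    DifferentiableAt ℝ (coupledRoot m τ) 0 := by
  have h0 : 0 < 9 * m * τ ^ 2 := by positivity
  have hd : DifferentiableAt ℝ (fun X : ℝ => √((3 * (6 + (m + 1) * τ) * X + 9 * m * τ ^ 2) ^ 2 -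
      4 * (9 * (3 + τ) * (3 + m * τ)) * X ^ 2)) 0 :=
    DifferentiableAt.sqrt (by fun_prop) (by simp; exact ⟨hm.ne', hτ.ne'⟩)
  unfold coupledRoot
  refine DifferentiableAt.sqrt (DifferentiableAt.div (by fun_prop) (by fun_prop) ?_) ?_
  · positivity
  · positivity

/-- The coupled modes form parabolic touches at the zeros of `F`, for any number of layers. -/
theorem IsFundamentalSystem.exists_parabolicBranches (h : IsFundamentalSystem q₀ c c₁ s s₁)
    (hq₀ : ContinuousOn q₀ (Icc (0 : ℝ) 1)) (heven : ∀ x ∈ Icc (0 : ℝ) 1, q₀ (1 - x) = q₀ x)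
    (ht₀ : 0 < t₀) (hn : 2 ≤ n) {θD : ℝ × ℝ} (hθ : θD ∈ diracPoints) {lamD : ℝ}
    (hD : c lamD 1 = 0) : ∃ κ : ℝ, 0 < κ ∧ ∃ lm lp : ℝ × ℝ → ℝ,
      ParabolicBranches (dispersionRelation n t₀ q₀) θD lamD κ (-κ) κ lm lp := by
  obtain ⟨β, hβ, hbranch⟩ := h.exists_touchingBranches (n := n) hq₀ heven ht₀ hD
  set τ := t₀ ^ 2 with hτ
  have hτ0 : 0 < τ := by positivity
  set m : ℝ := ((n - 1 : ℕ) : ℝ) with hm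
  have hm0 : 0 < m := by
    rw [hm]
    exact_mod_cast (show 0 < n - 1 by omega)
  set g := coupledRoot m τ with hg
  have hg0 : 0 < g 0 := coupledRoot_zero_pos hm0 hτ0
  have hX : Tendsto (fun θ => ‖F θ‖ ^ 2) (𝓝 θD) (𝓝 0) :=
    (continuous_F.norm.pow 2).tendsto' _ _ (by simp [F_eq_zero_of_mem_diracPoints hθ])
  have hXO := norm_F_sq_isBigO hθ
  have hgX : Tendsto (fun θ => g (‖F θ‖ ^ 2)) (𝓝 θD) (𝓝 (g 0)) :=
    (differentiableAt_coupledRoot hm0 hτ0).continuousAt.tendsto.comp hX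
  have hgO : (fun θ => g (‖F θ‖ ^ 2) - g 0) =O[𝓝 θD] fun θ => ‖θ - θD‖ ^ 2 := by
    have := (differentiableAt_coupledRoot hm0 hτ0).isBigO_sub.comp_tendsto hX
    refine Asymptotics.IsBigO.trans (this.congr_right fun θ => ?_) hXO
    simp
  have hw : Tendsto (fun θ => ‖F θ‖ ^ 2 * g (‖F θ‖ ^ 2)) (𝓝 θD) (𝓝 0) := by
    simpa using hX.mul hgX
  have hwO : (fun θ => ‖F θ‖ ^ 2 * g (‖F θ‖ ^ 2)) =O[𝓝 θD] fun θ => ‖θ - θD‖ ^ 2 := by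
    simpa using hXO.mul (hgX.isBigO_one ℝ)
  obtain ⟨lm, lp, hT, -⟩ := hbranch (fun θ => ‖F θ‖ ^ 2 * g (‖F θ‖ ^ 2))
    (fun δ => g 0 * normForm δ) 3 θD hw
    (Eventually.of_forall fun θ η hη => exists_vertexSystem_of_coupledSecular hn ht₀
      (coupledSecular_of_sq_eq hm0 hτ0 (by positivity) hη))
    (by
      have h1 := (hXO.mul hgO).trans ((Asymptotics.isBigO_of_le _ fun θ => by rw [← pow_add]).trans
        (norm_sub_pow_isBigO θD (show 3 ≤ 2 + 2 by norm_num)))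
      have h2 := (norm_F_sq_sub_normForm_isBigO hθ).const_mul_left (g 0)
      refine (h1.add h2).congr_left fun θ => ?_
      ring)
    (by
      have := (hwO.mul hwO).trans ((Asymptotics.isBigO_of_le _ fun θ => by rw [← pow_add]).trans
        (norm_sub_pow_isBigO θD (show 3 ≤ 2 + 2 by norm_num)))
      exact this.congr_left fun θ => by ring)
  have hκ : 0 < β * g 0 := mul_pos hβ hg0
  refine ⟨β * g 0, hκ, lm, lp, hκ, by nlinarith [mul_pos hκ hκ], ?_⟩
  rw [show form (β * g 0) (-(β * g 0)) (β * g 0) = fun δ => β * (g 0 * normForm δ) from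
    funext fun δ => by rw [form_eq_normForm, mul_assoc]]
  exact hT

theorem norm_F_sub_sqrt_isBigO {θD : ℝ × ℝ} (hθ : θD ∈ diracPoints) :
    (fun θ => ‖F θ‖ - √(normForm (θ - θD))) =O[𝓝 θD] fun θ => ‖θ - θD‖ ^ 2 := by
  obtain ⟨C, hC, hO⟩ := (norm_F_sq_sub_normForm_isBigO hθ).exists_pos
  refine Asymptotics.IsBigO.of_bound (2 * C) ?_
  filter_upwards [hO.bound] with θ hb
  rw [norm_pow, norm_norm, Real.norm_eq_abs] at hb ⊢
  set r := ‖θ - θD‖ with hr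
  set N := √(normForm (θ - θD)) with hN
  have hform := (normForm_bounds (θ - θD)).1
  have hr0 : 0 ≤ r := norm_nonneg _
  have hN2 : N ^ 2 = normForm (θ - θD) := Real.sq_sqrt (le_trans (by positivity) hform)
  have hN0 : 0 ≤ N := Real.sqrt_nonneg _
  have hNr : r / 2 ≤ N := by
    refine Real.le_sqrt_of_sq_le ?_
    nlinarith
  rw [← hN2, show ‖F θ‖ ^ 2 - N ^ 2 = (‖F θ‖ - N) * (‖F θ‖ + N) by ring, abs_mul,
    abs_of_nonneg (show 0 ≤ ‖F θ‖ + N by positivity)] at hb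
  rcases hr0.eq_or_lt with h0 | hpos
  · have hz : θ - θD = 0 := norm_eq_zero.1 (hr ▸ h0.symm)
    have hθ' : θ = θD := sub_eq_zero.1 hz
    rw [hN, hz, hθ', F_eq_zero_of_mem_diracPoints hθ]
    simp [normForm]
    positivity
  · have h1 : |‖F θ‖ - N| * (r / 2) ≤ C * r ^ 3 := by
      refine le_trans (mul_le_mul_of_nonneg_left ?_ (abs_nonneg _)) hb
      linarith [norm_nonneg (F θ)]
    have h2 : |‖F θ‖ - N| * (r / 2) ≤ (2 * C * r ^ 2) * (r / 2) := by
      have e : (2 * C * r ^ 2) * (r / 2) = C * r ^ 3 := by ring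
      rwa [e]
    exact le_of_mul_le_mul_right h2 (by positivity)

/-- The antisymmetric modes of the trilayer form Dirac cones at the zeros of `F`. -/
theorem IsFundamentalSystem.exists_diracBranches (h : IsFundamentalSystem q₀ c c₁ s s₁)
    (hq₀ : ContinuousOn q₀ (Icc (0 : ℝ) 1)) (heven : ∀ x ∈ Icc (0 : ℝ) 1, q₀ (1 - x) = q₀ x)
    (ht₀ : 0 < t₀) {θD : ℝ × ℝ} (hθ : θD ∈ diracPoints) {lamD : ℝ}
    (hD : c lamD 1 = 0) : ∃ γ : ℝ, 0 < γ ∧ ∃ lm lp : ℝ × ℝ → ℝ,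
      DiracBranches (dispersionRelation 3 t₀ q₀) θD lamD (γ ^ 2) (-γ ^ 2) (γ ^ 2) lm lp ∧
      ∃ ε : ℝ, (ε = 1 ∨ ε = -1) ∧ ∀ᶠ θ in 𝓝 θD,
        discriminant q₀ (lp θ) = ε * (2 * ‖F θ‖ / √(3 * (3 + t₀ ^ 2))) ∧
        discriminant q₀ (lm θ) = -ε * (2 * ‖F θ‖ / √(3 * (3 + t₀ ^ 2))) := by
  obtain ⟨β, hβ, hbranch⟩ := h.exists_touchingBranches (n := 3) hq₀ heven ht₀ hD
  set T := √(3 * (3 + t₀ ^ 2)) with hT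
  have hT0 : 0 < T := Real.sqrt_pos.2 (by positivity)
  have hT2 : T ^ 2 = 3 * (3 + t₀ ^ 2) := Real.sq_sqrt (by positivity)
  have hw : Tendsto (fun θ => ‖F θ‖ / T) (𝓝 θD) (𝓝 0) :=
    (continuous_F.norm.div_const T).tendsto' _ _ (by simp [F_eq_zero_of_mem_diracPoints hθ])
  obtain ⟨lm, lp, hTB, ε, hε, hdisc⟩ := hbranch (fun θ => ‖F θ‖ / T)
    (fun δ => √(normForm δ) / T) 2 θD hw
    (Eventually.of_forall fun θ η hη => exists_vertexSystem_of_freeSecular (by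
      rw [freeSecular, hη, div_pow, hT2]
      field_simp
      ring))
    (((norm_F_sub_sqrt_isBigO hθ).const_mul_left T⁻¹).congr_left fun θ => by
      field_simp)
    (((norm_F_sq_isBigO hθ).const_mul_left (T ^ 2)⁻¹).congr_left fun θ => by
      field_simp)
  have hγ : 0 < β / T := by positivity
  refine ⟨β / T, hγ, lm, lp, ⟨by positivity, ?_, ?_⟩, ε, hε, ?_⟩
  · have := pow_pos hγ 4
    nlinarith
  · rw [show (fun δ => √(form ((β / T) ^ 2) (-(β / T) ^ 2) ((β / T) ^ 2) δ)) =
      fun δ => β * (√(normForm δ) / T) from funext fun δ => by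
        rw [form_eq_normForm, Real.sqrt_mul (by positivity), Real.sqrt_sq hγ.le]
        ring]
    exact hTB
  · filter_upwards [hdisc] with θ h1
    rw [h.discriminant_eq_two_mul heven, h.discriminant_eq_two_mul heven, h1.1, h1.2]
    constructor <;> ring

end Branches

end BernalGraphene

theorem mainTheorem3 (t₀ : ℝ) (ht₀ : 0 < t₀) (q₀ : ℝ → ℝ)
    (hq₀ : ContinuousOn q₀ (Icc (0 : ℝ) 1)) (heven : ∀ x ∈ Icc (0 : ℝ) 1, q₀ (1 - x) = q₀ x) :
    {lam : ℝ | discriminant q₀ lam = 0}.Infinite ∧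
    -- bilayer: parabolic touches
    (∀ θD ∈ diracPoints, ∀ lamD : ℝ, discriminant q₀ lamD = 0 →
      ∃ κ : ℝ, 0 < κ ∧ ∃ lm lp : ℝ × ℝ → ℝ,
        ParabolicBranches (dispersionRelation 2 t₀ q₀) θD lamD κ (-κ) κ lm lp) ∧
    -- bilayer: no Dirac cone
    (∀ θD ∈ brillouinZone, ∀ lamD : ℝ, (θD ≠ 0 ∨ lamD ∉ dirichletSpectrum q₀) →
      ¬ HasDiracCone (dispersionRelation 2 t₀ q₀) θD lamD) ∧
    -- trilayer: Dirac cones and parabolic touches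
    (∀ θD ∈ diracPoints, ∀ lamD : ℝ, discriminant q₀ lamD = 0 →
      (∃ γ : ℝ, 0 < γ ∧ ∃ lm lp : ℝ × ℝ → ℝ,
        DiracBranches (dispersionRelation 3 t₀ q₀) θD lamD (γ ^ 2) (-γ ^ 2) (γ ^ 2) lm lp ∧
        ∃ ε : ℝ, (ε = 1 ∨ ε = -1) ∧ ∀ᶠ θ in 𝓝 θD,
          discriminant q₀ (lp θ) = ε * (2 * ‖F θ‖ / Real.sqrt (3 * (3 + t₀ ^ 2))) ∧
          discriminant q₀ (lm θ) = -ε * (2 * ‖F θ‖ / Real.sqrt (3 * (3 + t₀ ^ 2)))) ∧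
      ∃ κ : ℝ, 0 < κ ∧ ∃ lm lp : ℝ × ℝ → ℝ,
        ParabolicBranches (dispersionRelation 3 t₀ q₀) θD lamD κ (-κ) κ lm lp) ∧
    -- trilayer: there are no other Dirac cones
    (∀ θD ∈ brillouinZone, ∀ lamD : ℝ, (θD ≠ 0 ∨ lamD ∉ dirichletSpectrum q₀) →
      HasDiracCone (dispersionRelation 3 t₀ q₀) θD lamD →
        θD ∈ diracPoints ∧ discriminant q₀ lamD = 0) := by
  obtain ⟨c, c₁, s, s₁, h⟩ := exists_isFundamentalSystem hq₀
  have hzero : ∀ lam, discriminant q₀ lam = 0 ↔ c lam 1 = 0 := fun lam => by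
    rw [h.discriminant_eq_two_mul heven, mul_eq_zero, or_iff_right two_ne_zero]
  simp only [hzero]
  refine ⟨h.infinite_zeros hq₀,
    fun θD hθ lamD hD => h.exists_parabolicBranches hq₀ heven ht₀ le_rfl hθ hD,
    fun θD hθ lamD hgen => h.not_hasDiracCone_two hq₀ heven ht₀ hθ hgen,
    fun θD hθ lamD hD => ⟨h.exists_diracBranches hq₀ heven ht₀ hθ hD,
      h.exists_parabolicBranches hq₀ heven ht₀ (by norm_num) hθ hD⟩,
    fun θD hθ lamD hgen hcone => ?_⟩
  obtain ⟨hF, hD⟩ := h.of_hasDiracCone hq₀ heven ht₀ (by norm_num) hθ hgen hcone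
  exact ⟨mem_diracPoints_of_F_eq_zero hθ hF, hD⟩
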